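/- Theorem 8 (Type II superconductors). Let $\mathcal L=\mathbb Z v_1\oplus\mathbb Z v_2\subset\mathbb R^2$ be a lattice whose fundamental parallelogram $\Omega=\{t_1v_1+t_2v_2: 0\le t_1,t_2<1\}$ has area $1$. Let $\mathcal A$ be the set of pairs $(u,\mathbf a)$ such that - $u\in H^1_{loc}(\mathbb R^2;\mathbb C)$ and, for $v=v_1$ and $v=v_2$, $u(z+v)=e^{i\pi(v_xy-v_yx)}u(z)$ for almost every $z=(x,y)$ (that is, $u$ is an $H^1$ section of a line bundle of degree $1$ over $\mathbb R^2/\mathcal L$); - $\mathbf a\in H^1_{loc}(\mathbb R^2;\mathbb R^2)$ is $\mathcal L$-periodic, $\operatorname{div}\mathbf a=0$ and $\int_\Omega\mathbf a=0$. For $k,H_{ext},H_{int}>0$ and $(u,\mathbf a)\in\mathcal A$ put $\mu=\frac{H_{int}}{2\pi k}$, $\mathbf A_0(x,y)=\pi(-y,x)$ and $$E_{k,H_{ext}}(H_{int},u,\mathbf a)=\int_\Omega\Big(\frac{\mu}{2}\|i\nabla u+(\mathbf A_0+\mathbf a)u\|^2+\frac14(1-|u|^2)^2+\frac{\mu^2k^2}{2}|\operatorname{curl}\mathbf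 a|^2\Big)+\frac12(H_{int}-H_{ext})^2 .$$ Let $\mathcal E_{k,H_{ext}}$ be the infimum of $E_{k,H_{ext}}(H_{int},u,\mathbf a)$ over all $H_{int}>0$ and $(u,\mathbf a)\in\mathcal A$, let $E_{\mathcal N}=\frac14$ (the energy of the normal state $u=0$, $\mathbf a=0$, $H_{int}=H_{ext}$), and let $\mathcal N$ be the set of all $(k,H_{ext})$ with $k,H_{ext}>0$ and $\mathcal E_{k,H_{ext}}=E_{\mathcal N}$. Let $k\ge\frac1{\sqrt2}$ and $H_{ext}>0$. (i) If $H_{ext}\ge k$, then $\mathcal E_{k,H_{ext}}=E_{\mathcal N}$, this value is a minimum (it is attained), and $(k,H_{ext})\in\mathcal N$. (ii) If $H_{ext}<k$, then $(k,H_{ext})\notin\mathcal N$. -/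

import Mathlib

open MeasureTheory
open scoped ContDiff ENNReal

noncomputable section

namespace Abrikosov

/-- The Euclidean plane; the coordinates of `z` are `z 0` (that is, `x`) and `z 1` (that is, `y`). -/
abbrev Plane : Type := EuclideanSpace ℝ (Fin 2)

section Sobolev

variable {F : Type} [NormedAddCommGroup F] [NormedSpace ℝ F]

/-- `f` is square integrable on every compact subset of the plane. -/
def IsLocL2 (f : Plane → F) : Prop :=
  ∀ K : Set Plane, IsCompact K → MemLp f 2 (volume.restrict K)

/-- `g` is the weak (distributional) partial derivative of `f` in the `j`-th coordinate. -/
def IsWeakPartial (j : Fin 2) (f g : Plane → F) : Prop :=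
  ∀ φ : Plane → ℝ, ContDiff ℝ ∞ φ → HasCompactSupport φ →
    ∫ z, (fderiv ℝ φ z (EuclideanSpace.single j 1)) • f z = - ∫ z, φ z • g z

/-- `f` is of class `H¹_loc` on the plane, with weak partial derivatives `df 0` and `df 1`
(which are determined by `f` almost everywhere). -/
structure IsH1loc (f : Plane → F) (df : Fin 2 → Plane → F) : Prop where
  locL2 : IsLocL2 f
  locL2_deriv : ∀ j, IsLocL2 (df j)
  weak : ∀ j, IsWeakPartial j f (df j)

end Sobolev

/-- The potential `A₀ = π (-y, x)` of the constant field `2π`, by components. -/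
def A0 (z : Plane) : Fin 2 → ℝ := ![-(Real.pi * z 1), Real.pi * z 0]

/-- The factor `exp (i π (v_x y - v_y x))`. -/
def multiplier (v z : Plane) : ℂ :=
  Complex.exp (Complex.I * ((Real.pi * (v 0 * z 1 - v 1 * z 0) : ℝ) : ℂ))

/-- The space `𝒜` of pairs `(u, a)` attached to the lattice spanned over `ℤ` by the basis `b`:
`u` is an `H¹_loc` section of the degree one line bundle `E₁` on the torus, and `a` is an `H¹_loc`
vector field which is periodic, divergence free and of mean zero. The weak derivatives
`du j = ∂_j u` and `da j i = ∂_j a_i` are recorded along with the pair.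

The quasi-periodicity is imposed for the two generators of the lattice; it then follows for
`m b₀ + n b₁` with the multiplier times the sign `(-1)^(m n)`. (Without that sign the relations
for all lattice vectors would be incompatible, and only `u = 0` would satisfy them.) -/
structure State (b : Module.Basis (Fin 2) ℝ Plane) where
  u : Plane → ℂ
  du : Fin 2 → Plane → ℂ
  a : Fin 2 → Plane → ℝ
  da : Fin 2 → Fin 2 → Plane → ℝ
  u_H1 : IsH1loc u du
  u_quasiperiodic : ∀ i, ∀ᵐ z : Plane, u (z + b i) = multiplier (b i) z * u z
  a_H1 : ∀ i, IsH1loc (a i) (fun j => da j i)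
  a_periodic : ∀ l i, ∀ᵐ z : Plane, a i (z + b l) = a i z
  a_div : ∀ᵐ z : Plane, da 0 0 z + da 1 1 z = 0
  a_mean : ∀ i, ∫ z in ZSpan.fundamentalDomain b, a i z = 0

variable {b : Module.Basis (Fin 2) ℝ Plane}

/-- `‖i ∇u + (A₀ + a) u‖²`. -/
def State.kinetic (s : State b) (z : Plane) : ℝ :=
  ∑ j, ‖Complex.I * s.du j z + ((A0 z j + s.a j z : ℝ) : ℂ) * s.u z‖ ^ 2

/-- `curl a = ∂_x a_y - ∂_y a_x`. -/
def State.curl (s : State b) (z : Plane) : ℝ := s.da 0 1 z - s.da 1 0 z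

/-- The density of the internal energy, with `μ = H_int / (2 π k)`. -/
def State.density (s : State b) (k Hint : ℝ) (z : Plane) : ℝ :=
  let μ : ℝ := Hint / (2 * Real.pi * k)
  μ / 2 * s.kinetic z + 1 / 4 * (1 - ‖s.u z‖ ^ 2) ^ 2 + μ ^ 2 * k ^ 2 / 2 * s.curl z ^ 2

/-- The internal energy `E_{k, H_int}(u, a)` for `k, H_int > 0`: the integral of the (then
nonnegative) density over the fundamental parallelogram, as an element of `[0, ∞]`. -/
def State.internalEnergy (s : State b) (k Hint : ℝ) : ℝ≥0∞ :=
  ∫⁻ z in ZSpan.fundamentalDomain b, ENNReal.ofReal (s.density k Hint z)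

/-- The energy `E_{k, H_ext}(H_int, u, a)`. -/
def State.energy (s : State b) (k Hext Hint : ℝ) : ℝ≥0∞ :=
  s.internalEnergy k Hint + ENNReal.ofReal (1 / 2 * (Hint - Hext) ^ 2)

variable (b)

/-- All the values of the energy, over `H_int > 0` and `(u, a) ∈ 𝒜`. -/
def energyValues (k Hext : ℝ) : Set ℝ≥0∞ :=
  {e | ∃ Hint : ℝ, 0 < Hint ∧ ∃ s : State b, s.energy k Hext Hint = e}

/-- The minimal energy `ℰ_{k, H_ext}`. -/
def minEnergy (k Hext : ℝ) : ℝ≥0∞ := sInf (energyValues b k Hext)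

/-- The energy `E_𝒩 = 1/4` of the normal state. -/
def normalEnergy : ℝ≥0∞ := 1 / 4

/-- The set `𝒩` of the parameters `(k, H_ext)` for which the normal state is minimizing. -/
def normalSet : Set (ℝ × ℝ) :=
  {p | 0 < p.1 ∧ 0 < p.2 ∧ minEnergy b p.1 p.2 = normalEnergy}

end Abrikosov

end

/-! The argument is Bogomolny's. Write D for the covariant gradient and w = |u|². Pointwise, |Du|²
plus the curl of the supercurrent Im(u · conj Du) equals |D₀u + i D₁u|² + (2π + curl a) w. The
supercurrent is gauge invariant, hence periodic, so its curl has integral zero over a cell, and the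
kinetic energy equals ∫ |D₀u + i D₁u|² + ∫ (2π + curl a) w (`State.setIntegral_kinetic`).

For H_ext ≥ k, drop the first square. Since curl a has mean zero, a multiple of it may be added so
that the field terms form the single square t²/2 with t = H_int - H_ext + μ k curl a. The integrand
becomes (H_ext + t) w/(2k) + (1 - w)²/4 + t²/2, which is at least 1/4 pointwise when k² ≥ 1/2
(`quarter_le_energy_density`, `State.quarter_le`). The normal state attains 1/4.

For H_ext < k, take a = 0, H_int = H_ext and u a small multiple of a nonzero solution of D₀u + i D₁u
= 0, namely a Gaussian times a Jacobi theta function. The term of the energy quadratic in u has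
coefficient proportional to H_ext/k - 1 < 0, so the energy falls below 1/4 (`exists_energy_lt`).

The analytic work is to justify the curl identity for H¹_loc data. Mollification gives a product
rule and a Jacobian identity for weak derivatives, and the embedding H¹_loc ⊂ L⁴_loc makes every
product integrable. Averaging a test function over all translations turns weak identities for
periodic functions into integrals over a cell. -/

noncomputable section

namespace Abrikosov

open Filter Topology Set
open scoped Convolution

/-! ### Local integrability -/

/-- `f` is in `L^p` on every compact subset of the plane. -/
def IsLocLp {F : Type} [NormedAddCommGroup F] (p : ℝ≥0∞) (f : Plane → F) : Prop :=
  ∀ K : Set Plane, IsCompact K → MemLp f p (volume.restrict K)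

section LocLp

variable {F : Type} [NormedAddCommGroup F] {p q r : ℝ≥0∞} {f g : Plane → F}

lemma IsLocLp.mono_exponent (hf : IsLocLp p f) (h : q ≤ p) : IsLocLp q f := fun K hK => by
  have : IsFiniteMeasure (volume.restrict K) := ⟨by simpa using hK.measure_lt_top⟩
  exact (hf K hK).mono_exponent h

lemma IsLocLp.add (hf : IsLocLp p f) (hg : IsLocLp p g) : IsLocLp p (fun z => f z + g z) :=
  fun K hK => (hf K hK).add (hg K hK)

lemma IsLocLp.sub (hf : IsLocLp p f) (hg : IsLocLp p g) : IsLocLp p (fun z => f z - g z) :=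
  fun K hK => (hf K hK).sub (hg K hK)

lemma IsLocLp.congr (hf : IsLocLp p f) (h : f =ᵐ[volume] g) : IsLocLp p g :=
  fun K hK => (memLp_congr_ae (ae_restrict_of_ae h)).1 (hf K hK)

lemma IsLocLp.norm (hf : IsLocLp p f) : IsLocLp p (fun z => ‖f z‖) :=
  fun K hK => (hf K hK).norm

lemma IsLocLp.locallyIntegrable (hf : IsLocLp p f) (hp : 1 ≤ p) : LocallyIntegrable f volume := by
  rw [locallyIntegrable_iff]
  intro K hK
  exact memLp_one_iff_integrable.1 ((hf.mono_exponent hp) K hK)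

lemma IsLocLp.integrableOn (hf : IsLocLp p f) (hp : 1 ≤ p) {S : Set Plane}
    (hS : Bornology.IsBounded S) : IntegrableOn f S volume :=
  ((hf.locallyIntegrable hp).integrableOn_isCompact hS.isCompact_closure).mono_set subset_closure

lemma _root_.Continuous.isLocLp (hf : Continuous f) : IsLocLp p f := fun K hK => by
  have : IsFiniteMeasure (volume.restrict K) := ⟨by simpa using hK.measure_lt_top⟩
  obtain ⟨C, hC⟩ := hK.exists_bound_of_continuousOn hf.continuousOn
  refine (memLp_top_of_bound hf.aestronglyMeasurable C ?_).mono_exponent le_top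
  exact (ae_restrict_iff' hK.measurableSet).2 (ae_of_all _ hC)

lemma IsLocLp.aestronglyMeasurable (hf : IsLocLp p f) : AEStronglyMeasurable f volume := by
  have h : volume = Measure.restrict volume (⋃ n : ℕ, Metric.closedBall (0 : Plane) n) := by
    rw [Metric.iUnion_closedBall_nat, Measure.restrict_univ]
  rw [h, aestronglyMeasurable_iUnion_iff]
  exact fun n => (hf _ (isCompact_closedBall _ _)).aestronglyMeasurable

lemma IsLocLp.memLp (hf : IsLocLp p f) {K : Set Plane} (hK : IsCompact K)
    (h : ∀ z ∉ K, f z = 0) : MemLp f p volume := by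
  have := (memLp_indicator_iff_restrict hK.measurableSet).2 (hf K hK)
  rwa [indicator_eq_self.2 (fun z hz => by_contra fun h' => hz (h z h'))] at this

lemma IsLocLp.memLp_of_hasCompactSupport (hf : IsLocLp p f) (h : HasCompactSupport f) :
    MemLp f p volume :=
  hf.memLp h fun _ hz => image_eq_zero_of_notMem_tsupport hz

lemma IsLocLp.smul [NormedSpace ℝ F] {φ : Plane → ℝ} (hφ : IsLocLp p φ) (hf : IsLocLp q f)
    [ENNReal.HolderTriple p q r] : IsLocLp r (fun z => φ z • f z) :=
  fun K hK => (hf K hK).smul (hφ K hK)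

lemma IsLocLp.mul {f g : Plane → ℝ} (hf : IsLocLp p f) (hg : IsLocLp q g)
    [ENNReal.HolderTriple p q r] : IsLocLp r (fun z => f z * g z) :=
  fun K hK => (hg K hK).mul (hf K hK)

lemma IsLocLp.mulC {f g : Plane → ℂ} (hf : IsLocLp p f) (hg : IsLocLp q g)
    [ENNReal.HolderTriple p q r] : IsLocLp r (fun z => f z * g z) :=
  fun K hK => (hg K hK).mul (hf K hK)

lemma IsLocLp.continuous_smul [NormedSpace ℝ F] {φ : Plane → ℝ} (hf : IsLocLp p f)
    (hφ : Continuous φ) : IsLocLp p (fun z => φ z • f z) :=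
  (hφ.isLocLp (p := ∞)).smul hf

lemma IsLocLp.continuous_mul {φ f : Plane → ℝ} (hf : IsLocLp p f) (hφ : Continuous φ) :
    IsLocLp p (fun z => φ z * f z) :=
  (hφ.isLocLp (p := ∞)).mul hf

lemma IsLocLp.continuous_mulC {φ f : Plane → ℂ} (hf : IsLocLp p f) (hφ : Continuous φ) :
    IsLocLp p (fun z => φ z * f z) :=
  (hφ.isLocLp (p := ∞)).mulC hf

lemma IsLocLp.const_mul {f : Plane → ℝ} (hf : IsLocLp p f) (c : ℝ) :
    IsLocLp p (fun z => c * f z) :=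
  hf.continuous_mul (φ := fun _ => c) continuous_const

lemma IsLocLp.integrable_smul [NormedSpace ℝ F] {φ : Plane → ℝ} (hf : IsLocLp p f) (hp : 1 ≤ p)
    (hφ : Continuous φ) (hc : HasCompactSupport φ) : Integrable (fun z => φ z • f z) volume :=
  memLp_one_iff_integrable.1 <|
    ((hf.mono_exponent hp).continuous_smul hφ).memLp_of_hasCompactSupport hc.smul_right

lemma IsLocLp.comp_add_right (hf : IsLocLp p f) (v : Plane) : IsLocLp p (fun z => f (z + v)) := by
  intro K hK
  have hK' : IsCompact ((fun z => z + v) '' K) := hK.image (by fun_prop)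
  have hm : MeasurePreserving (fun z : Plane => z + v) (volume.restrict K)
      (volume.restrict ((fun z => z + v) '' K)) :=
    (measurePreserving_add_right volume v).restrict_image_emb (measurableEmbedding_addRight v) K
  exact (hf _ hK').comp_measurePreserving hm

end LocLp

/-! ### Test functions -/

/-- The `j`-th coordinate vector. -/
abbrev coordVec (j : Fin 2) : Plane := EuclideanSpace.single j 1

lemma continuous_partial {φ : Plane → ℝ} (hφ : ContDiff ℝ ∞ φ) (v : Plane) :
    Continuous fun z => fderiv ℝ φ z v :=
  (hφ.continuous_fderiv (by simp)).clm_apply continuous_const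

lemma hasCompactSupport_partial {φ : Plane → ℝ} (hc : HasCompactSupport φ) (v : Plane) :
    HasCompactSupport fun z => fderiv ℝ φ z v :=
  (hc.fderiv (𝕜 := ℝ)).comp_left (g := fun L : Plane →L[ℝ] ℝ => L v) rfl

lemma contDiff_partial {φ : Plane → ℝ} (hφ : ContDiff ℝ ∞ φ) (v : Plane) :
    ContDiff ℝ ∞ fun z => fderiv ℝ φ z v :=
  (hφ.fderiv_right (m := ∞) (by simp)).clm_apply contDiff_const

/-! ### Mollification -/

/-- A sequence of bump functions shrinking to the origin. -/
def bumpSeq (n : ℕ) : ContDiffBump (0 : Plane) where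
  rIn := 1 / (n + 1) / 2
  rOut := 1 / (n + 1)
  rIn_pos := by positivity
  rIn_lt_rOut := half_lt_self (by positivity)

/-- The normalized bump functions. -/
def bumpFn (n : ℕ) : Plane → ℝ := (bumpSeq n).normed volume

lemma tendsto_bumpSeq_rOut : Tendsto (fun n => (bumpSeq n).rOut) atTop (𝓝 0) :=
  tendsto_one_div_add_atTop_nhds_zero_nat

lemma contDiff_bumpFn (n : ℕ) : ContDiff ℝ ∞ (bumpFn n) := (bumpSeq n).contDiff_normed

lemma hasCompactSupport_bumpFn (n : ℕ) : HasCompactSupport (bumpFn n) :=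
  (bumpSeq n).hasCompactSupport_normed

lemma bumpFn_nonneg (n : ℕ) (z : Plane) : 0 ≤ bumpFn n z := (bumpSeq n).nonneg_normed z

lemma integral_bumpFn (n : ℕ) : ∫ z, bumpFn n z = 1 := (bumpSeq n).integral_normed

lemma bumpFn_eq_zero (n : ℕ) {t : Plane} (ht : 1 < ‖t‖) : bumpFn n t = 0 := by
  have h : t ∉ Function.support ((bumpSeq n).normed volume) := by
    rw [ContDiffBump.support_normed_eq]
    simp only [Metric.mem_ball, dist_zero_right, not_lt]
    refine le_trans ?_ ht.le
    change (1 : ℝ) / (n + 1) ≤ 1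
    rw [div_le_one (by positivity)]
    linarith [(Nat.cast_nonneg n : (0 : ℝ) ≤ n)]
  exact Function.notMem_support.1 h

/-- The mollification of a function. -/
def mollify (n : ℕ) (f : Plane → ℝ) : Plane → ℝ :=
  bumpFn n ⋆[ContinuousLinearMap.lsmul ℝ ℝ, volume] f

lemma mollify_apply (n : ℕ) (f : Plane → ℝ) (z : Plane) :
    mollify n f z = ∫ t, bumpFn n t * f (z - t) := rfl

lemma contDiff_mollify {f : Plane → ℝ} (hf : LocallyIntegrable f volume) (n : ℕ) :
    ContDiff ℝ ∞ (mollify n f) :=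
  (hasCompactSupport_bumpFn n).contDiff_convolution_left (n := ⊤) _ (contDiff_bumpFn n) hf

/-- Mollification commutes with weak derivatives. -/
lemma fderiv_mollify {f df : Plane → ℝ} {j : Fin 2} (hf : LocallyIntegrable f volume)
    (hw : IsWeakPartial j f df) (n : ℕ) (z : Plane) :
    fderiv ℝ (mollify n f) z (coordVec j) = mollify n df z := by
  have hρ := contDiff_bumpFn n
  have h1 := ((hasCompactSupport_bumpFn n).hasFDerivAt_convolution_left
    (ContinuousLinearMap.lsmul ℝ ℝ) (μ := volume) (hρ.of_le (by simp)) hf z)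
  rw [mollify, h1.fderiv]
  have hex : ConvolutionExistsAt (fderiv ℝ (bumpFn n)) f z
      (ContinuousLinearMap.precompL Plane (ContinuousLinearMap.lsmul ℝ ℝ)) volume :=
    ((hasCompactSupport_bumpFn n).fderiv (𝕜 := ℝ)).convolutionExists_left _
      (hρ.continuous_fderiv (by simp)) hf z
  rw [convolution_def, ContinuousLinearMap.integral_apply hex.integrable]
  simp only [ContinuousLinearMap.precompL_apply, ContinuousLinearMap.lsmul_apply, smul_eq_mul]
  -- The reflected and translated bump is itself a test function; the sign from the reflection
  -- cancels the one in the weak derivative.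
  have h2 := hw (fun s => bumpFn n (z - s)) (hρ.comp (contDiff_const.sub contDiff_id))
    ((hasCompactSupport_bumpFn n).comp_homeomorph (Homeomorph.subLeft z))
  have h3 : ∀ s, fderiv ℝ (fun s => bumpFn n (z - s)) s (coordVec j)
      = - fderiv ℝ (bumpFn n) (z - s) (coordVec j) := by
    intro s
    have : HasFDerivAt (fun s => bumpFn n (z - s))
        ((fderiv ℝ (bumpFn n) (z - s)).comp (-ContinuousLinearMap.id ℝ Plane)) s :=
      ((hρ.differentiable (by simp)) (z - s)).hasFDerivAt.comp s
        ((hasFDerivAt_id s).const_sub z)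
    rw [this.fderiv]
    simp
  simp only [h3, smul_eq_mul, neg_mul, integral_neg, neg_inj] at h2
  rw [mollify_apply, ← integral_sub_left_eq_self _ volume z,
    ← integral_sub_left_eq_self (fun t => bumpFn n t * df (z - t)) volume z]
  simpa using h2

section Pairing

variable {p q : ℝ≥0∞} {g h : Plane → ℝ}

/-- `L^p` and `L^q` translates pair continuously. -/
lemma continuous_integral_mul_sub (hp1 : 1 ≤ p) (hp : p ≠ ⊤) [ENNReal.HolderConjugate p q]
    (hh : MemLp h p volume) (hg : MemLp g q volume) :
    Continuous fun t : Plane => ∫ z, h (z - t) * g z := by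
  have : Fact (1 ≤ p) := ⟨hp1⟩
  have : Fact (1 ≤ q) := ⟨ENNReal.HolderConjugate.one_le q p⟩
  let T : Plane → C(Plane, Plane) := fun t => ⟨fun z => z - t, by fun_prop⟩
  have hT : Continuous T := by
    refine ContinuousMap.continuous_of_continuous_uncurry _ ?_
    change Continuous fun x : Plane × Plane => x.2 - x.1
    fun_prop
  have hTm : ∀ t, MeasurePreserving (T t) volume volume := fun t =>
    measurePreserving_sub_right volume t
  -- Translation is continuous in L^p for p < ∞; the Hölder pairing with the fixed g then preserves
  -- continuity.
  have hc := Continuous.compMeasurePreservingLp (μ := volume) (ν := volume)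
    (continuous_const (y := hh.toLp h)) hT hTm hp
  have hc2 := (((ContinuousLinearMap.lsmul ℝ ℝ).lpPairing volume p q).continuous.comp hc).clm_apply
    (continuous_const (y := hg.toLp g))
  refine hc2.congr fun t => ?_
  simp only [Function.comp]
  rw [ContinuousLinearMap.lpPairing_eq_integral]
  refine integral_congr_ae ?_
  have e1 := Lp.coeFn_compMeasurePreserving (hh.toLp h) (hTm t)
  have e2 := (hTm t).quasiMeasurePreserving.ae_eq_comp hh.coeFn_toLp
  filter_upwards [e1, e2, hg.coeFn_toLp] with z h1 h2 h3
  rw [h1, h2, h3]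
  rfl

/-- Fubini. Absolute integrability on the product holds because the pairing of |g| with translates
of |h| is continuous in the translation, and the bump has compact support. -/
lemma integral_mollify_mul (hp1 : 1 ≤ p) (hp : p ≠ ⊤) [ENNReal.HolderConjugate p q]
    (hh : MemLp h p volume) (hg : MemLp g q volume) (n : ℕ) :
    ∫ z, mollify n h z * g z = ∫ t, bumpFn n t * ∫ z, h (z - t) * g z := by
  have hρ : Integrable (bumpFn n) volume :=
    (contDiff_bumpFn n).continuous.integrable_of_hasCompactSupport (hasCompactSupport_bumpFn n)
  have hm : ∀ t : Plane, MemLp (fun z => h (z - t)) p volume := fun t =>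
    hh.comp_measurePreserving (measurePreserving_sub_right volume t)
  have hi : ∀ t : Plane, Integrable (fun z => h (z - t) * g z) volume := fun t =>
    memLp_one_iff_integrable.1 (hg.mul (hm t))
  have hint : Integrable (fun x : Plane × Plane => bumpFn n x.1 * (h (x.2 - x.1) * g x.2))
      (volume.prod volume) := by
    have hmeas : AEStronglyMeasurable
        (fun x : Plane × Plane => bumpFn n x.1 * (h (x.2 - x.1) * g x.2))
        (volume.prod volume) := by
      refine hρ.aestronglyMeasurable.comp_fst.mul (AEStronglyMeasurable.mul ?_ ?_)
      · exact hh.aestronglyMeasurable.comp_quasiMeasurePreserving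
          ((quasiMeasurePreserving_sub volume volume).comp
            Measure.measurePreserving_swap.quasiMeasurePreserving)
      · exact hg.aestronglyMeasurable.comp_snd
    rw [integrable_prod_iff hmeas]
    refine ⟨ae_of_all _ fun t => (hi t).const_mul (bumpFn n t), ?_⟩
    simp only [norm_mul, integral_const_mul]
    have hcn := continuous_integral_mul_sub hp1 hp hh.norm hg.norm
    exact ((contDiff_bumpFn n).continuous.norm.mul hcn).integrable_of_hasCompactSupport
      ((hasCompactSupport_bumpFn n).norm.mul_right)
  simp only [mollify_apply, ← integral_mul_const, ← integral_const_mul, mul_assoc]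
  exact (integral_integral_swap (f := fun t z => bumpFn n t * (h (z - t) * g z)) hint).symm

/-- After Fubini the left side is the bump convolved with a continuous function of the translation,
evaluated at the origin, so it is an ordinary approximate identity. -/
lemma tendsto_integral_mollify_mul_of_memLp (hp1 : 1 ≤ p) (hp : p ≠ ⊤)
    [ENNReal.HolderConjugate p q] (hh : MemLp h p volume) (hg : MemLp g q volume) :
    Tendsto (fun n => ∫ z, mollify n h z * g z) atTop (𝓝 (∫ z, h z * g z)) := by
  simp only [integral_mollify_mul hp1 hp hh hg]
  have hc : Continuous fun t : Plane => ∫ z, h (z + t) * g z := by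
    simpa [Function.comp_def] using (continuous_integral_mul_sub hp1 hp hh hg).comp continuous_neg
  have := ContDiffBump.convolution_tendsto_right_of_continuous (μ := volume)
    tendsto_bumpSeq_rOut hc (0 : Plane)
  simp only [convolution_def, ContinuousLinearMap.lsmul_apply, zero_sub, smul_eq_mul, add_zero]
    at this
  simpa only [sub_eq_add_neg, bumpFn] using this

/-- Mollifications of an `L^p_loc` function converge weakly. -/
lemma tendsto_integral_mollify_mul (hp1 : 1 ≤ p) (hp : p ≠ ⊤) [ENNReal.HolderConjugate p q]
    (hh : IsLocLp p h) (hg : MemLp g q volume) (hgc : HasCompactSupport g) :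
    Tendsto (fun n => ∫ z, mollify n h z * g z) atTop (𝓝 (∫ z, h z * g z)) := by
  obtain ⟨R, hR⟩ := hgc.isBounded.subset_closedBall (0 : Plane)
  -- Every bump is supported in the closed unit ball, so on the support of g the mollification sees
  -- h only within radius R + 1. Truncating there makes h globally L^p without changing any pairing.
  set S := Metric.closedBall (0 : Plane) (R + 1)
  have hS : MemLp (S.indicator h) p volume :=
    (memLp_indicator_iff_restrict Metric.isClosed_closedBall.measurableSet).2
      (hh _ (isCompact_closedBall _ _))
  have key := tendsto_integral_mollify_mul_of_memLp hp1 hp hS hg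
  have hz : ∀ z, g z ≠ 0 → ‖z‖ ≤ R := fun z hz => by
    simpa using hR (subset_tsupport g hz)
  have e0 : ∫ z, S.indicator h z * g z = ∫ z, h z * g z := by
    congr 1; ext z
    by_cases hgz : g z = 0
    · simp [hgz]
    · rw [indicator_of_mem]
      have := hz z hgz
      simp only [S, Metric.mem_closedBall, dist_zero_right]; linarith
  rw [← e0]
  refine key.congr fun n => ?_
  congr 1; ext z
  by_cases hgz : g z = 0
  · simp [hgz]
  congr 1
  rw [mollify_apply, mollify_apply]
  congr 1; ext t
  by_cases ht : 1 < ‖t‖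
  · simp [bumpFn_eq_zero n ht]
  · rw [indicator_of_mem]
    have := hz z hgz
    simp only [S, Metric.mem_closedBall, dist_zero_right]
    linarith [norm_sub_le z t]

end Pairing

/-! ### Calculus of weak partial derivatives -/

section Weak

variable {F : Type} [NormedAddCommGroup F] [NormedSpace ℝ F] {j : Fin 2}

lemma integrable_test_smul {f : Plane → F} (hf : IsLocLp 1 f) {φ : Plane → ℝ}
    (hφ : ContDiff ℝ ∞ φ) (hc : HasCompactSupport φ) : Integrable (fun z => φ z • f z) volume :=
  hf.integrable_smul le_rfl hφ.continuous hc

lemma integrable_partial_smul {f : Plane → F} (hf : IsLocLp 1 f) {φ : Plane → ℝ}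
    (hφ : ContDiff ℝ ∞ φ) (hc : HasCompactSupport φ) (v : Plane) :
    Integrable (fun z => fderiv ℝ φ z v • f z) volume :=
  hf.integrable_smul le_rfl (continuous_partial hφ v) (hasCompactSupport_partial hc v)

lemma IsWeakPartial.congr {f df g dg : Plane → F} (h : IsWeakPartial j f df)
    (hf : f =ᵐ[volume] g) (hd : df =ᵐ[volume] dg) : IsWeakPartial j g dg := by
  intro φ hφ hc
  have h1 := h φ hφ hc
  rw [integral_congr_ae (hf.mono fun z hz => by simp only [hz] :
      (fun z => fderiv ℝ φ z (coordVec j) • f z) =ᵐ[volume]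
        fun z => fderiv ℝ φ z (coordVec j) • g z),
    integral_congr_ae (hd.mono fun z hz => by simp only [hz] :
      (fun z => φ z • df z) =ᵐ[volume] fun z => φ z • dg z)] at h1
  exact h1

lemma IsWeakPartial.add {f df g dg : Plane → F} (h : IsWeakPartial j f df)
    (h' : IsWeakPartial j g dg) (hf : IsLocLp 1 f) (hdf : IsLocLp 1 df) (hg : IsLocLp 1 g)
    (hdg : IsLocLp 1 dg) :
    IsWeakPartial j (fun z => f z + g z) (fun z => df z + dg z) := by
  intro φ hφ hc
  simp only [smul_add]
  rw [integral_add (integrable_partial_smul hf hφ hc _) (integrable_partial_smul hg hφ hc _),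
    integral_add (integrable_test_smul hdf hφ hc) (integrable_test_smul hdg hφ hc),
    h φ hφ hc, h' φ hφ hc]
  abel

lemma IsWeakPartial.clm_comp {G : Type} [NormedAddCommGroup G] [NormedSpace ℝ G]
    [CompleteSpace F] [CompleteSpace G] (L : F →L[ℝ] G)
    {f df : Plane → F} (h : IsWeakPartial j f df) (hf : IsLocLp 1 f) (hdf : IsLocLp 1 df) :
    IsWeakPartial j (fun z => L (f z)) (fun z => L (df z)) := by
  intro φ hφ hc
  simp only [← L.map_smul]
  rw [L.integral_comp_comm (integrable_partial_smul hf hφ hc _),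
    L.integral_comp_comm (integrable_test_smul hdf hφ hc), h φ hφ hc, map_neg]

/-- The product of a weakly differentiable function and a smooth function. -/
lemma IsWeakPartial.smooth_smul {f df : Plane → F} (h : IsWeakPartial j f df) (hf : IsLocLp 1 f)
    (hdf : IsLocLp 1 df) {m : Plane → ℝ} (hm : ContDiff ℝ ∞ m) :
    IsWeakPartial j (fun z => m z • f z)
      (fun z => m z • df z + fderiv ℝ m z (coordVec j) • f z) := by
  intro φ hφ hc
  have hφm : ContDiff ℝ ∞ (fun z => φ z * m z) := hφ.mul hm
  have hcm : HasCompactSupport (fun z => φ z * m z) := hc.mul_right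
  have h1 := h _ hφm hcm
  have hd : ∀ z, fderiv ℝ (fun z => φ z * m z) z (coordVec j)
      = fderiv ℝ φ z (coordVec j) * m z + φ z * fderiv ℝ m z (coordVec j) := by
    intro z
    rw [fderiv_fun_mul (hφ.differentiable (by simp) z) (hm.differentiable (by simp) z)]
    simp
    ring
  simp only [hd, add_smul, mul_smul] at h1
  have i1 : Integrable (fun z => fderiv ℝ φ z (coordVec j) • m z • f z) volume :=
    integrable_partial_smul (hf.continuous_smul hm.continuous) hφ hc _
  have i2 : Integrable (fun z => φ z • fderiv ℝ m z (coordVec j) • f z) volume :=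
    integrable_test_smul (hf.continuous_smul (continuous_partial hm _)) hφ hc
  have i3 : Integrable (fun z => φ z • m z • df z) volume :=
    integrable_test_smul (hdf.continuous_smul hm.continuous) hφ hc
  rw [integral_add i1 i2] at h1
  simp only [smul_add]
  rw [integral_add i3 i2, neg_add, ← h1]
  abel

/-- Classical derivatives are weak derivatives. -/
lemma isWeakPartial_of_contDiff {f : Plane → F} (hf : ContDiff ℝ 1 f) (j : Fin 2) :
    IsWeakPartial j f (fun z => fderiv ℝ f z (coordVec j)) := by
  intro φ hφ hc
  have c1 : Continuous fun z => fderiv ℝ f z (coordVec j) :=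
    (hf.continuous_fderiv one_ne_zero).clm_apply continuous_const
  have := integral_smul_fderiv_eq_neg_fderiv_smul_of_integrable (μ := volume) (f := φ) (g := f)
    (v := coordVec j) (integrable_partial_smul hf.continuous.isLocLp hφ hc _)
    (integrable_test_smul c1.isLocLp hφ hc)
    (integrable_test_smul hf.continuous.isLocLp hφ hc)
    (fun z _ => hφ.differentiable (by simp) z)
    (fun z _ => hf.differentiable one_ne_zero z)
  rw [this, neg_neg]

/-- Weak derivatives are unique. -/
lemma IsWeakPartial.unique {f g df dg : Plane → F} [CompleteSpace F]
    (h : IsWeakPartial j f df) (h' : IsWeakPartial j g dg) (hfg : f =ᵐ[volume] g)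
    (hdf : IsLocLp 1 df) (hdg : IsLocLp 1 dg) : df =ᵐ[volume] dg := by
  refine ae_eq_of_integral_contDiff_smul_eq (hdf.locallyIntegrable le_rfl)
    (hdg.locallyIntegrable le_rfl) fun φ hφ hc => ?_
  have h1 := h φ hφ hc
  have h2 := (h'.congr hfg.symm (ae_eq_refl _)) φ hφ hc
  exact neg_injective (h1.symm.trans h2)

lemma IsWeakPartial.comp_add_right {f df : Plane → F} (h : IsWeakPartial j f df) (v : Plane) :
    IsWeakPartial j (fun z => f (z + v)) (fun z => df (z + v)) := by
  intro φ hφ hc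
  have h1 := h (fun z => φ (z - v)) (hφ.comp (contDiff_id.sub contDiff_const))
    (hc.comp_homeomorph (Homeomorph.subRight v))
  have hd : ∀ z, fderiv ℝ (fun z => φ (z - v)) z = fderiv ℝ φ (z - v) := fun z => by
    simpa [sub_eq_add_neg] using fderiv_comp_add_right (𝕜 := ℝ) (f := φ) (x := z) (-v)
  simp only [hd] at h1
  rw [← integral_add_right_eq_self _ v, ← integral_add_right_eq_self (fun z => φ (z - v) • df z) v]
    at h1
  simpa using h1

end Weak

section Product

variable {j : Fin 2} {f df g dg : Plane → ℝ}

/-- The product rule for weak derivatives. -/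
theorem IsWeakPartial.mul {p q : ℝ≥0∞} [ENNReal.HolderConjugate p q] (hp : p ≠ ⊤)
    (hf : IsWeakPartial j f df) (hg : IsWeakPartial j g dg)
    (hf2 : IsLocLp 2 f) (hfp : IsLocLp p f) (hdf : IsLocLp 2 df)
    (hg2 : IsLocLp 2 g) (hdg : IsLocLp q dg) :
    IsWeakPartial j (fun z => f z * g z) (fun z => f z * dg z + df z * g z) := by
  intro φ hφ hc
  have hp1 : 1 ≤ p := ENNReal.HolderConjugate.one_le p q
  have hq1 : 1 ≤ q := ENNReal.HolderConjugate.one_le q p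
  have hf1 := hf2.mono_exponent one_le_two
  have hg1 := hg2.mono_exponent one_le_two
  have c1 : HasCompactSupport fun z => fderiv ℝ φ z (coordVec j) * g z :=
    (hasCompactSupport_partial hc (coordVec j)).mul_right
  have c2 : HasCompactSupport fun z => φ z * dg z := hc.mul_right
  have c3 : HasCompactSupport fun z => φ z * g z := hc.mul_right
  have m1 := (hg2.continuous_mul (continuous_partial hφ (coordVec j))).memLp_of_hasCompactSupport c1
  have m2 := (hdg.continuous_mul hφ.continuous).memLp_of_hasCompactSupport c2
  have m3 := (hg2.continuous_mul hφ.continuous).memLp_of_hasCompactSupport c3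
  -- Only f is mollified: the smooth product rule holds for each n, and each of its three terms
  -- converges as a pairing. The pair (p, q) enters only in the term f · dg.
  have t1 := tendsto_integral_mollify_mul one_le_two (by simp) hf2 m1 c1
  have t2 := tendsto_integral_mollify_mul hp1 hp hfp m2 c2
  have t3 := tendsto_integral_mollify_mul one_le_two (by simp) hdf m3 c3
  have hn : ∀ n, ∫ z, mollify n f z * (fderiv ℝ φ z (coordVec j) * g z)
      = -(∫ z, mollify n f z * (φ z * dg z)) + -∫ z, mollify n df z * (φ z * g z) := by
    intro n
    have hm := contDiff_mollify (hf1.locallyIntegrable le_rfl) n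
    have := hg.smooth_smul hg1 (hdg.mono_exponent hq1) hm φ hφ hc
    simp only [fderiv_mollify (hf1.locallyIntegrable le_rfl) hf, smul_eq_mul, mul_add] at this
    have i1 : Integrable (fun z => φ z * (mollify n f z * dg z)) volume :=
      integrable_test_smul ((hdg.mono_exponent hq1).continuous_mul hm.continuous) hφ hc
    have hcd : Continuous (mollify n df) := by
      simp only [funext fun z => (fderiv_mollify (hf1.locallyIntegrable le_rfl) hf n z).symm]
      exact continuous_partial hm _
    have i2 : Integrable (fun z => φ z * (mollify n df z * g z)) volume :=
      integrable_test_smul (hg1.continuous_mul hcd) hφ hc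
    rw [integral_add i1 i2, neg_add] at this
    simpa only [mul_left_comm] using this
  have lim := tendsto_nhds_unique (t1.congr hn) (t2.neg.add t3.neg)
  have i1 : Integrable (fun z => f z * (φ z * dg z)) volume := by
    have h1 : IsLocLp 1 (fun z => f z * dg z) := hfp.mul hdg
    simpa only [mul_left_comm, smul_eq_mul] using integrable_test_smul h1 hφ hc
  have i2 : Integrable (fun z => df z * (φ z * g z)) volume := by
    have h1 : IsLocLp 1 (fun z => df z * g z) := hdf.mul hg2
    simpa only [mul_left_comm, smul_eq_mul] using integrable_test_smul h1 hφ hc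
  simp only [smul_eq_mul, mul_add, mul_left_comm (φ _), mul_left_comm (fderiv ℝ φ _ _)]
  rw [lim, integral_add i1 i2, neg_add]

/-- The weak curl of `f ∇ g` is the Jacobian of `(f, g)`. -/
theorem integral_curl_mul_grad {f g : Plane → ℝ} {df dg : Fin 2 → Plane → ℝ}
    (hf : IsH1loc f df) (hg : IsH1loc g dg) {χ : Plane → ℝ} (hχ : ContDiff ℝ ∞ χ)
    (hc : HasCompactSupport χ) :
    ∫ z, (fderiv ℝ χ z (coordVec 0) * (f z * dg 1 z) - fderiv ℝ χ z (coordVec 1) * (f z * dg 0 z))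
      = - ∫ z, χ z * (df 0 z * dg 1 z - df 1 z * dg 0 z) := by
  have hf2 : IsLocLp 2 f := hf.locL2
  have hg2 : IsLocLp 2 g := hg.locL2
  have hdf : ∀ j, IsLocLp 2 (df j) := hf.locL2_deriv
  have hdg : ∀ j, IsLocLp 2 (dg j) := hg.locL2_deriv
  have one2 : ∀ {h : Plane → ℝ}, IsLocLp 2 h → IsLocLp 1 h := fun h => h.mono_exponent one_le_two
  have hgl := (one2 hg2).locallyIntegrable le_rfl
  have cP : ∀ i, HasCompactSupport fun z => fderiv ℝ χ z (coordVec i) * f z := fun i =>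
    (hasCompactSupport_partial hc (coordVec i)).mul_right
  have cQ : ∀ i, HasCompactSupport fun z => χ z * df i z := fun i => hc.mul_right
  have mP := fun i => (hf2.continuous_mul
    (continuous_partial hχ (coordVec i))).memLp_of_hasCompactSupport (cP i)
  have mQ := fun i => ((hdf i).continuous_mul hχ.continuous).memLp_of_hasCompactSupport (cQ i)
  have tP := fun i k => tendsto_integral_mollify_mul one_le_two (by simp) (hdg k) (mP i) (cP i)
  have tQ := fun i k => tendsto_integral_mollify_mul one_le_two (by simp) (hdg k) (mQ i) (cQ i)
  -- With g replaced by its mollification, the second derivatives that appear are mixed partials of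
  -- a smooth function, and they cancel in the curl. What remains involves first derivatives only
  -- and passes to the limit.
  have hn : ∀ n, (∫ z, mollify n (dg 1) z * (fderiv ℝ χ z (coordVec 0) * f z))
        - (∫ z, mollify n (dg 0) z * (fderiv ℝ χ z (coordVec 1) * f z))
      = -((∫ z, mollify n (dg 1) z * (χ z * df 0 z)) - ∫ z, mollify n (dg 0) z * (χ z * df 1 z)) := by
    intro n
    have hm := contDiff_mollify hgl n
    have hme : ∀ k, mollify n (dg k) = fun z => fderiv ℝ (mollify n g) z (coordVec k) :=
      fun k => funext fun z => (fderiv_mollify hgl (hg.weak k) n z).symm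
    have hmk : ∀ k, ContDiff ℝ ∞ (mollify n (dg k)) := fun k => by
      rw [hme]; exact contDiff_partial hm _
    have hmix : ∀ z, fderiv ℝ (mollify n (dg 1)) z (coordVec 0)
        = fderiv ℝ (mollify n (dg 0)) z (coordVec 1) := by
      intro z
      have hs : IsSymmSndFDerivAt ℝ (mollify n g) z :=
        (hm.contDiffAt (x := z)).isSymmSndFDerivAt (by simpa using ENat.LEInfty.out)
      have hdd : DifferentiableAt ℝ (fderiv ℝ (mollify n g)) z :=
        ((hm.fderiv_right (m := ∞) (by simp)).differentiable (by simp)) z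
      rw [hme, hme, fderiv_clm_apply hdd (by fun_prop), fderiv_clm_apply hdd (by fun_prop)]
      simpa using hs (coordVec 0) (coordVec 1)
    have key : ∀ i k, ∫ z, mollify n (dg k) z * (fderiv ℝ χ z (coordVec i) * f z)
        = -(∫ z, mollify n (dg k) z * (χ z * df i z))
          - ∫ z, fderiv ℝ (mollify n (dg k)) z (coordVec i) * (χ z * f z) := by
      intro i k
      have := (hf.weak i).smooth_smul (one2 hf2) (one2 (hdf i)) (hmk k) χ hχ hc
      simp only [smul_eq_mul, mul_add] at this
      have i1 : Integrable (fun z => χ z * (mollify n (dg k) z * df i z)) volume :=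
        integrable_test_smul ((one2 (hdf i)).continuous_mul (hmk k).continuous) hχ hc
      have i2 : Integrable (fun z => χ z * (fderiv ℝ (mollify n (dg k)) z (coordVec i) * f z))
          volume :=
        integrable_test_smul ((one2 hf2).continuous_mul (continuous_partial (hmk k) _)) hχ hc
      rw [integral_add i1 i2, neg_add, ← sub_eq_add_neg] at this
      simpa only [mul_left_comm] using this
    rw [key 0 1, key 1 0]
    simp only [hmix]
    ring
  have lim := tendsto_nhds_unique (((tP 0 1).sub (tP 1 0)).congr hn) ((tQ 0 1).sub (tQ 1 0)).neg
  have iP : ∀ i k, Integrable (fun z => dg k z * (fderiv ℝ χ z (coordVec i) * f z)) volume := by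
    intro i k
    have h1 : IsLocLp 1 (fun z => dg k z * f z) := (hdg k).mul hf2
    simpa only [mul_left_comm, smul_eq_mul] using integrable_partial_smul h1 hχ hc (coordVec i)
  have iQ : ∀ i k, Integrable (fun z => dg k z * (χ z * df i z)) volume := by
    intro i k
    have h1 : IsLocLp 1 (fun z => dg k z * df i z) := (hdg k).mul (hdf i)
    simpa only [mul_left_comm, smul_eq_mul] using integrable_test_smul h1 hχ hc
  rw [← integral_sub (iP 0 1) (iP 1 0), ← integral_sub (iQ 0 1) (iQ 1 0)] at lim
  calc _ = _ := integral_congr_ae (ae_of_all _ fun z => by ring)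
    _ = _ := lim
    _ = _ := congrArg _ (integral_congr_ae (ae_of_all _ fun z => by ring))

end Product

/-! ### The embedding of `H¹_loc` in `L⁴_loc` -/

/-- Young's inequality for a nonnegative kernel of mass one. -/
lemma eLpNorm_mollify_one_le {h : Plane → ℝ} (hh : Integrable h volume) (n : ℕ) :
    eLpNorm (mollify n h) 1 volume ≤ eLpNorm h 1 volume := by
  rw [eLpNorm_one_eq_lintegral_enorm, eLpNorm_one_eq_lintegral_enorm]
  have hmeas : AEMeasurable (fun x : Plane × Plane => ‖bumpFn n x.2‖ₑ * ‖h (x.1 - x.2)‖ₑ)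
      (volume.prod volume) := by
    have h1 : AEMeasurable (fun x : Plane × Plane => ‖bumpFn n x.2‖ₑ) (volume.prod volume) :=
      ((contDiff_bumpFn n).continuous.comp continuous_snd).enorm.aemeasurable
    have h2 : AEMeasurable (fun x : Plane × Plane => ‖h (x.1 - x.2)‖ₑ) (volume.prod volume) :=
      (hh.aestronglyMeasurable.comp_quasiMeasurePreserving
        (quasiMeasurePreserving_sub volume volume)).enorm
    exact h1.mul h2
  calc ∫⁻ z, ‖mollify n h z‖ₑ ≤ ∫⁻ z, ∫⁻ t, ‖bumpFn n t‖ₑ * ‖h (z - t)‖ₑ := by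
        refine lintegral_mono fun z => ?_
        rw [mollify_apply]
        refine (enorm_integral_le_lintegral_enorm _).trans_eq ?_
        simp only [enorm_mul]
    _ = ∫⁻ t, ∫⁻ z, ‖bumpFn n t‖ₑ * ‖h (z - t)‖ₑ := lintegral_lintegral_swap hmeas
    _ = ∫⁻ t, ‖bumpFn n t‖ₑ * ∫⁻ z, ‖h z‖ₑ := by
        refine lintegral_congr fun t => ?_
        rw [lintegral_const_mul' _ _ enorm_ne_top, lintegral_sub_right_eq_self (fun z => ‖h z‖ₑ) t]
    _ = (∫⁻ t, ‖bumpFn n t‖ₑ) * ∫⁻ z, ‖h z‖ₑ :=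
        lintegral_mul_const _ (contDiff_bumpFn n).continuous.enorm.measurable
    _ = ∫⁻ z, ‖h z‖ₑ := by
        have hi : Integrable (bumpFn n) volume :=
          (contDiff_bumpFn n).continuous.integrable_of_hasCompactSupport
            (hasCompactSupport_bumpFn n)
        have : ∫⁻ t, ‖bumpFn n t‖ₑ = 1 := by
          rw [← ofReal_integral_norm_eq_lintegral_enorm hi]
          simp only [Real.norm_of_nonneg (bumpFn_nonneg n _), integral_bumpFn, ENNReal.ofReal_one]
        rw [this, one_mul]

lemma norm_clm_le_sum (L : Plane →L[ℝ] ℝ) : ‖L‖ ≤ ‖L (coordVec 0)‖ + ‖L (coordVec 1)‖ := by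
  refine L.opNorm_le_bound (by positivity) fun z => ?_
  have hz : z = z 0 • coordVec 0 + z 1 • coordVec 1 := by
    ext i; fin_cases i <;> simp
  have hn : ∀ i, ‖z i‖ ≤ ‖z‖ := fun i => PiLp.norm_apply_le z i
  calc ‖L z‖ = ‖z 0 * L (coordVec 0) + z 1 * L (coordVec 1)‖ := by
        conv_lhs => rw [hz]
        rw [map_add, map_smul, map_smul, smul_eq_mul, smul_eq_mul]
    _ ≤ ‖z 0‖ * ‖L (coordVec 0)‖ + ‖z 1‖ * ‖L (coordVec 1)‖ := by
        refine (norm_add_le _ _).trans_eq ?_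
        rw [norm_mul, norm_mul]
    _ ≤ (‖L (coordVec 0)‖ + ‖L (coordVec 1)‖) * ‖z‖ := by
        have := mul_le_mul_of_nonneg_right (hn 0) (norm_nonneg (L (coordVec 0)))
        have := mul_le_mul_of_nonneg_right (hn 1) (norm_nonneg (L (coordVec 1)))
        linarith

/-- A compactly supported `W^{1,1}` function on the plane is square integrable. -/
theorem memLp_two_of_isWeakPartial {f : Plane → ℝ} {df : Fin 2 → Plane → ℝ}
    (hf : Integrable f volume) (hc : HasCompactSupport f) (hdf : ∀ j, Integrable (df j) volume)
    (hw : ∀ j, IsWeakPartial j f (df j)) : MemLp f 2 volume := by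
  have hfl := hf.locallyIntegrable
  -- The Gagliardo–Nirenberg–Sobolev exponent for W^{1,1} is conjugate to the dimension, and 2 is
  -- self-conjugate.
  have hconj : NNReal.HolderConjugate (Module.finrank ℝ Plane) 2 := by
    rw [finrank_euclideanSpace_fin]
    rw [NNReal.holderConjugate_iff]
    norm_num
  set C := eLpNormLESNormFDerivOneConst (E := Plane) (volume : Measure Plane) (2 : NNReal)
  have hm := fun n => contDiff_mollify hfl n
  have hB : ∀ n, eLpNorm (mollify n f) 2 volume
      ≤ C * (eLpNorm (df 0) 1 volume + eLpNorm (df 1) 1 volume) := by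
    intro n
    have h1 := eLpNorm_le_eLpNorm_fderiv_one (μ := (volume : Measure Plane)) (u := mollify n f)
      ((hm n).of_le (by simp)) ((hasCompactSupport_bumpFn n).convolution _ hc) hconj
    refine h1.trans ?_
    gcongr
    have hcont : ∀ j, Continuous (mollify n (df j)) := fun j => by
      simp only [funext fun z => (fderiv_mollify hfl (hw j) n z).symm]
      exact continuous_partial (hm n) _
    have h2 : eLpNorm (fderiv ℝ (mollify n f)) 1 volume
        ≤ eLpNorm (fun z => ‖mollify n (df 0) z‖ + ‖mollify n (df 1) z‖) 1 volume := by
      refine eLpNorm_mono_real fun z => ?_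
      rw [← fderiv_mollify hfl (hw 0), ← fderiv_mollify hfl (hw 1)]
      exact norm_clm_le_sum _
    refine h2.trans ((eLpNorm_add_le (hcont 0).norm.aestronglyMeasurable
      (hcont 1).norm.aestronglyMeasurable le_rfl).trans ?_)
    rw [eLpNorm_norm, eLpNorm_norm]
    exact add_le_add (eLpNorm_mollify_one_le (hdf 0) n) (eLpNorm_mollify_one_le (hdf 1) n)
  have hae : ∀ᵐ z, Tendsto (fun n => mollify n f z) atTop (𝓝 (f z)) := by
    refine ContDiffBump.ae_convolution_tendsto_right_of_locallyIntegrable (K := 2)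
      tendsto_bumpSeq_rOut (Eventually.of_forall fun n => ?_) hfl
    simp only [bumpSeq]
    linarith
  refine ⟨hf.aestronglyMeasurable, ?_⟩
  -- Fatou: the mollifications converge almost everywhere and their L² norms are bounded uniformly
  -- in n.
  refine (Lp.eLpNorm_lim_le_liminf_eLpNorm (fun n => (hm n).continuous.aestronglyMeasurable)
    f hae).trans_lt ?_
  refine (liminf_le_of_le (a := C * (eLpNorm (df 0) 1 volume + eLpNorm (df 1) 1 volume))
    (by isBoundedDefault) fun b hb => ?_).trans_lt ?_
  · obtain ⟨n, hn⟩ := hb.exists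
    exact hn.trans (hB n)
  · exact ENNReal.mul_lt_top ENNReal.coe_lt_top (ENNReal.add_lt_top.2
      ⟨(memLp_one_iff_integrable.2 (hdf 0)).2, (memLp_one_iff_integrable.2 (hdf 1)).2⟩)

/-- `H¹_loc` functions on the plane are in `L⁴_loc`. -/
theorem IsH1loc.isLocLp_four {f : Plane → ℝ} {df : Fin 2 → Plane → ℝ} (hf : IsH1loc f df) :
    IsLocLp 4 f := by
  have hf2 : IsLocLp 2 f := hf.locL2
  have hdf : ∀ j, IsLocLp 2 (df j) := hf.locL2_deriv
  intro K hK
  obtain ⟨R, hR⟩ := hK.isBounded.subset_closedBall (0 : Plane)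
  let η : ContDiffBump (0 : Plane) := ⟨|R| + 1, |R| + 2, by positivity, by linarith⟩
  have hη : ContDiff ℝ ∞ η := η.contDiff
  have hηc : HasCompactSupport η := η.hasCompactSupport
  set G : Plane → ℝ := fun z => η z * f z
  set dG : Fin 2 → Plane → ℝ := fun j z => η z * df j z + fderiv ℝ η z (coordVec j) * f z
  have hG : IsLocLp 2 G := hf2.continuous_mul hη.continuous
  have hdG : ∀ j, IsLocLp 2 (dG j) := fun j =>
    ((hdf j).continuous_mul hη.continuous).add (hf2.continuous_mul (continuous_partial hη _))
  have hGw : ∀ j, IsWeakPartial j G (dG j) := fun j =>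
    (hf.weak j).smooth_smul (hf2.mono_exponent one_le_two) ((hdf j).mono_exponent one_le_two) hη
  have hGc : HasCompactSupport G := hηc.mul_right
  -- The square of the cut-off function lies in W^{1,1}, since its derivative is a product of two L²
  -- functions. Hence the square is in L², and the function is in L⁴.
  have hGG : MemLp (fun z => G z * G z) 2 volume := by
    refine memLp_two_of_isWeakPartial (df := fun j z => G z * dG j z + dG j z * G z)
      ?_ hGc.mul_right (fun j => ?_)
      (fun j => (hGw j).mul (p := 2) (q := 2) (by simp) (hGw j) hG hG (hdG j) hG (hdG j))
    · have h1 : IsLocLp 1 (fun z => G z * G z) := hG.mul hG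
      exact memLp_one_iff_integrable.1 (h1.memLp_of_hasCompactSupport hGc.mul_right)
    · have h1 : IsLocLp 1 (fun z => G z * dG j z + dG j z * G z) :=
        (hG.mul (hdG j)).add ((hdG j).mul hG)
      exact memLp_one_iff_integrable.1
        (h1.memLp_of_hasCompactSupport (hGc.mul_right.add hGc.mul_left))
  have h4 : MemLp G 4 volume := by
    rw [← memLp_norm_rpow_iff (q := 2) hG.aestronglyMeasurable (by simp) (by simp)]
    have : (4 : ℝ≥0∞) / 2 = 2 := by
      refine (ENNReal.eq_div_iff (by simp) (by simp)).2 (by norm_num) |>.symm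
    rw [this]
    refine hGG.congr_norm (hG.aestronglyMeasurable.norm.aemeasurable.pow_const
      _).aestronglyMeasurable (ae_of_all _ fun z => ?_)
    simp [← sq]
  refine (h4.restrict K).ae_eq ?_
  refine (ae_restrict_iff' hK.measurableSet).2 (ae_of_all _ fun z hz => ?_)
  have : η z = 1 := by
    refine η.one_of_mem_closedBall ?_
    have := hR hz
    simp only [Metric.mem_closedBall, dist_zero_right, η] at this ⊢
    linarith [le_abs_self R]
  simp [G, this]

/-! ### Periodic functions -/

section Periodic

variable {b : Module.Basis (Fin 2) ℝ Plane} {f : Plane → ℝ}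

/-- Almost everywhere invariance under the generators of a lattice is invariance under the
lattice. -/
lemma ae_periodic_span (hf : ∀ i, ∀ᵐ z : Plane, f (z + b i) = f z) :
    ∀ᵐ z : Plane, ∀ l : Submodule.span ℤ (range b), f (z + l) = f z := by
  let S : AddSubgroup Plane :=
    { carrier := {l | ∀ᵐ z : Plane, f (z + l) = f z}
      zero_mem' := by simp
      add_mem' := by
        intro k l hk hl
        have := (measurePreserving_add_right volume k).quasiMeasurePreserving.ae hl
        filter_upwards [hk, this] with z h1 h2
        rw [← add_assoc, h2, h1]
      neg_mem' := by
        intro k hk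
        have := (measurePreserving_add_right volume (-k)).quasiMeasurePreserving.ae hk
        filter_upwards [this] with z h1
        rw [← h1, neg_add_cancel_right] }
  have hS : Submodule.span ℤ (range b) ≤ AddSubgroup.toIntSubmodule S := by
    rw [Submodule.span_le]
    rintro _ ⟨i, rfl⟩
    exact hf i
  exact ae_all_iff.2 fun l => hS l.2

variable (b) in
/-- The everywhere periodic function that agrees with `f` on the fundamental parallelogram. -/
def periodize (f : Plane → ℝ) (z : Plane) : ℝ := f (ZSpan.fract b z)

lemma periodize_ae_eq (hf : ∀ i, ∀ᵐ z : Plane, f (z + b i) = f z) :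
    periodize b f =ᵐ[volume] f := by
  filter_upwards [ae_periodic_span hf] with z hz
  have := hz (-ZSpan.floor b z)
  rw [periodize, ZSpan.fract_apply, sub_eq_add_neg]
  simpa using this

/-- The integral of a periodic function over a translate of the fundamental parallelogram. -/
lemma setIntegral_comp_add_right (hf : ∀ i, ∀ᵐ z : Plane, f (z + b i) = f z) (v : Plane) :
    ∫ z in ZSpan.fundamentalDomain b, f (v + z) = ∫ z in ZSpan.fundamentalDomain b, f z := by
  have : VAddInvariantMeasure (Submodule.span ℤ (range b)) Plane volume :=
    ⟨fun l s _ => measure_preimage_add volume (l : Plane) s⟩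
  have hD := ZSpan.isAddFundamentalDomain b (volume : Measure Plane)
  have hper : ∀ (l : Submodule.span ℤ (range b)) (z : Plane),
      periodize b f (l +ᵥ z) = periodize b f z := fun l z => by
    simp only [periodize, Submodule.vadd_def, vadd_eq_add, ZSpan.fract_zSpan_add b z l.2]
  -- A translate of a fundamental domain is again one, and a periodic function has the same integral
  -- over both.
  have h1 := (hD.vadd_of_comm v).setIntegral_eq hD hper
  have e := periodize_ae_eq hf
  have e' := (measurePreserving_add_left volume v).quasiMeasurePreserving.ae_eq_comp e
  rw [← integral_congr_ae (ae_restrict_of_ae e), ← h1]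
  refine (integral_congr_ae (ae_restrict_of_ae e'.symm)).trans ?_
  exact ((measurePreserving_add_left volume v).setIntegral_image_emb
    (measurableEmbedding_addLeft v) (periodize b f) _).symm

/-- Averaging a test function against a periodic function over all translations. -/
lemma integral_translate_test (hf1 : IsLocLp 1 f) (hf : ∀ i, ∀ᵐ z : Plane, f (z + b i) = f z)
    {φ : Plane → ℝ} (hφ : Continuous φ) (hc : HasCompactSupport φ) :
    IntegrableOn (fun s => ∫ z, φ (z - s) * f z) (ZSpan.fundamentalDomain b) volume ∧
    ∫ s in ZSpan.fundamentalDomain b, ∫ z, φ (z - s) * f z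
      = (∫ z, φ z) * ∫ z in ZSpan.fundamentalDomain b, f z := by
  set D := ZSpan.fundamentalDomain b
  have hDm : MeasurableSet D := ZSpan.fundamentalDomain_measurableSet b
  have e1 : ∀ s : Plane, ∫ z, φ (z - s) * f z = ∫ z, φ z * f (z + s) := fun s => by
    rw [← integral_add_right_eq_self _ s]
    simp only [add_sub_cancel_right]
  simp only [e1]
  obtain ⟨R, hR⟩ := (ZSpan.fundamentalDomain_isBounded b).subset_closedBall (0 : Plane)
  obtain ⟨R', hR'⟩ := hc.isBounded.subset_closedBall (0 : Plane)
  -- For z in the support of φ and s in the cell, z + s stays in this ball. Replacing f by its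
  -- truncation therefore changes nothing and gives the integrability needed for Fubini.
  set h := (Metric.closedBall (0 : Plane) (R' + R)).indicator f
  have hh : Integrable h volume := by
    rw [integrable_indicator_iff Metric.isClosed_closedBall.measurableSet]
    exact hf1.integrableOn le_rfl Metric.isBounded_closedBall
  have i1 : Integrable (fun x : Plane × Plane => φ x.1 * h (x.1 + x.2)) (volume.prod volume) :=
    (measurePreserving_prod_add volume volume).integrable_comp_of_integrable
      ((hφ.integrable_of_hasCompactSupport hc).mul_prod hh)
  have i2 : Integrable (fun x : Plane × Plane => φ x.1 * f (x.1 + x.2))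
      (volume.prod (volume.restrict D)) := by
    have i3 : Integrable (fun x : Plane × Plane => φ x.1 * h (x.1 + x.2))
        (volume.prod (volume.restrict D)) := by
      have := i1.restrict (s := univ ×ˢ D)
      rwa [← Measure.prod_restrict, Measure.restrict_univ] at this
    refine i3.congr ?_
    have hae : ∀ᵐ x ∂((volume : Measure Plane).prod (volume.restrict D)), x.2 ∈ D := by
      have : (volume : Measure Plane).prod (volume.restrict D)
          = (volume.prod volume).restrict (univ ×ˢ D) := by
        rw [← Measure.prod_restrict, Measure.restrict_univ]
      rw [this]
      filter_upwards [ae_restrict_mem (MeasurableSet.univ.prod hDm)] with x hx using hx.2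
    filter_upwards [hae] with x hx
    by_cases hz : φ x.1 = 0
    · simp [hz]
    · have h1 := hR hx
      have h2 := hR' (subset_tsupport φ hz)
      simp only [Metric.mem_closedBall, dist_zero_right] at h1 h2
      simp only [h]
      rw [indicator_of_mem]
      simp only [Metric.mem_closedBall, dist_zero_right]
      linarith [norm_add_le x.1 x.2]
  refine ⟨i2.integral_prod_right, ?_⟩
  rw [← integral_integral_swap (f := fun z s => φ z * f (z + s)) i2]
  simp only [integral_const_mul, setIntegral_comp_add_right hf, D, integral_mul_const]

/-- The weak curl of a periodic field has integral zero. -/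
theorem setIntegral_weak_curl_eq_zero {J : Fin 2 → Plane → ℝ} {G : Plane → ℝ}
    (hJ : ∀ j, IsLocLp 1 (J j)) (hG : IsLocLp 1 G)
    (hJp : ∀ j i, ∀ᵐ z : Plane, J j (z + b i) = J j z)
    (hGp : ∀ i, ∀ᵐ z : Plane, G (z + b i) = G z)
    (hw : ∀ χ : Plane → ℝ, ContDiff ℝ ∞ χ → HasCompactSupport χ →
      (∫ z, fderiv ℝ χ z (coordVec 0) * J 1 z) - (∫ z, fderiv ℝ χ z (coordVec 1) * J 0 z)
        = - ∫ z, χ z * G z) :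
    ∫ z in ZSpan.fundamentalDomain b, G z = 0 := by
  -- Test with all translates of one bump and average over the cell. The derivatives of the bump
  -- have integral zero, which removes J, while the bump has integral one, which leaves the integral
  -- of G.
  have hχ := contDiff_bumpFn 0
  have hc := hasCompactSupport_bumpFn 0
  have hd : ∀ s z, fderiv ℝ (fun z => bumpFn 0 (z - s)) z = fderiv ℝ (bumpFn 0) (z - s) :=
    fun s z => by
      simpa [sub_eq_add_neg] using fderiv_comp_add_right (𝕜 := ℝ) (f := bumpFn 0) (x := z) (-s)
  have h0 : ∀ j, ∫ z, fderiv ℝ (bumpFn 0) z (coordVec j) = 0 := fun j => by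
    have := isWeakPartial_of_contDiff (f := fun _ : Plane => (1 : ℝ)) contDiff_const j _ hχ hc
    simpa using this
  have key : ∀ s, (∫ z, fderiv ℝ (bumpFn 0) (z - s) (coordVec 0) * J 1 z)
      - (∫ z, fderiv ℝ (bumpFn 0) (z - s) (coordVec 1) * J 0 z)
        = - ∫ z, bumpFn 0 (z - s) * G z := fun s => by
    have := hw (fun z => bumpFn 0 (z - s)) (hχ.comp (contDiff_id.sub contDiff_const))
      (hc.comp_homeomorph (Homeomorph.subRight s))
    simpa only [hd] using this
  have t1 := integral_translate_test (hJ 1) (hJp 1) (continuous_partial hχ (coordVec 0))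
    (hasCompactSupport_partial hc _)
  have t0 := integral_translate_test (hJ 0) (hJp 0) (continuous_partial hχ (coordVec 1))
    (hasCompactSupport_partial hc _)
  have tG := integral_translate_test hG hGp hχ.continuous hc
  have := integral_congr_ae (μ := volume.restrict (ZSpan.fundamentalDomain b)) (ae_of_all _ key)
  rw [integral_sub t1.1 t0.1, t1.2, t0.2, integral_neg, tG.2, h0, h0, integral_bumpFn] at this
  linarith

end Periodic

/-! ### Covariant derivatives -/

/-- The exponents behind the product A|u|²: L⁴ · L⁴ puts |u|² in L², L⁴ · L² puts its gradient in
L^{4/3}, and L^{4/3} is dual to the L⁴ of the potential. -/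
instance : ENNReal.HolderTriple 4 4 2 := ⟨by
  rw [← ENNReal.toReal_eq_toReal_iff' (by simp) (by simp), ENNReal.toReal_add (by simp) (by simp)]
  norm_num⟩

instance : ENNReal.HolderTriple 4 2 (4 / 3) := ⟨by
  rw [ENNReal.inv_div (by simp) (by simp), ← ENNReal.toReal_eq_toReal_iff' (by simp)
    (by finiteness), ENNReal.toReal_add (by simp) (by simp)]
  norm_num⟩

instance : ENNReal.HolderConjugate 4 (4 / 3) := ⟨by
  rw [ENNReal.inv_div (by simp) (by simp), ← ENNReal.toReal_eq_toReal_iff' (by finiteness)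
    (by simp), ENNReal.toReal_add (by simp) (by finiteness)]
  norm_num⟩

section Complex

variable {j : Fin 2} {f df : Plane → ℂ}

/-- Reduces to real factors by m f = (Re m) f + (Im m)(i f). -/
lemma IsWeakPartial.smooth_mulC (h : IsWeakPartial j f df) (hf : IsLocLp 1 f)
    (hdf : IsLocLp 1 df) {m : Plane → ℂ} (hm : ContDiff ℝ ∞ m) :
    IsWeakPartial j (fun z => m z * f z)
      (fun z => m z * df z + fderiv ℝ m z (coordVec j) * f z) := by
  have hre : ContDiff ℝ ∞ fun z => (m z).re := Complex.reCLM.contDiff.comp hm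
  have him : ContDiff ℝ ∞ fun z => (m z).im := Complex.imCLM.contDiff.comp hm
  let L : ℂ →L[ℝ] ℂ := ContinuousLinearMap.mul ℝ ℂ Complex.I
  have hIf : IsLocLp 1 fun z => L (f z) := hf.continuous_mulC (φ := fun _ => Complex.I)
    continuous_const
  have hIdf : IsLocLp 1 fun z => L (df z) := hdf.continuous_mulC (φ := fun _ => Complex.I)
    continuous_const
  have h1 := h.smooth_smul hf hdf hre
  have h2 := (h.clm_comp L hf hdf).smooth_smul hIf hIdf him
  have h3 := h1.add h2 (hf.continuous_smul hre.continuous)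
    ((hdf.continuous_smul hre.continuous).add (hf.continuous_smul (continuous_partial hre _)))
    (hIf.continuous_smul him.continuous)
    ((hIdf.continuous_smul him.continuous).add (hIf.continuous_smul (continuous_partial him _)))
  have dre : ∀ z, fderiv ℝ (fun z => (m z).re) z (coordVec j) = (fderiv ℝ m z (coordVec j)).re := by
    intro z
    have := (Complex.reCLM.hasFDerivAt.comp z (hm.differentiable (by simp) z).hasFDerivAt).fderiv
    exact congrArg (fun T : Plane →L[ℝ] ℝ => T (coordVec j)) this
  have dim : ∀ z, fderiv ℝ (fun z => (m z).im) z (coordVec j) = (fderiv ℝ m z (coordVec j)).im := by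
    intro z
    have := (Complex.imCLM.hasFDerivAt.comp z (hm.differentiable (by simp) z).hasFDerivAt).fderiv
    exact congrArg (fun T : Plane →L[ℝ] ℝ => T (coordVec j)) this
  refine h3.congr (ae_of_all _ fun z => ?_) (ae_of_all _ fun z => ?_)
  · apply Complex.ext <;> simp [L]; ring
  · simp only [dre, dim]
    apply Complex.ext <;> simp [L] <;> ring

end Complex

lemma contDiff_multiplier (v : Plane) : ContDiff ℝ ∞ (multiplier v) := by
  unfold multiplier
  have h : ContDiff ℝ ∞ fun z : Plane => Real.pi * (v 0 * z 1 - v 1 * z 0) := by fun_prop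
  exact (contDiff_const.mul (Complex.ofRealCLM.contDiff.comp h)).cexp

lemma norm_multiplier (v z : Plane) : ‖multiplier v z‖ = 1 := by
  rw [multiplier, mul_comm, Complex.norm_exp_ofReal_mul_I]

/-- The logarithmic derivative of the multiplier is i times the change of A₀ under the translation.
This is what makes covariant derivatives transform like u. -/
lemma fderiv_multiplier (v z : Plane) (j : Fin 2) :
    fderiv ℝ (multiplier v) z (coordVec j)
      = Complex.I * ((A0 (z + v) j - A0 z j : ℝ) : ℂ) * multiplier v z := by
  have h0 : ∀ i : Fin 2, HasFDerivAt (fun z : Plane => z i) (EuclideanSpace.proj (𝕜 := ℝ) i) z :=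
    fun i => (EuclideanSpace.proj (𝕜 := ℝ) i : Plane →L[ℝ] ℝ).hasFDerivAt
  have h1 := (((h0 1).const_mul (v 0)).sub ((h0 0).const_mul (v 1))).const_mul Real.pi
  have h2 := ((Complex.ofRealCLM.hasFDerivAt.comp z h1).const_mul Complex.I).cexp
  have h3 : HasFDerivAt (multiplier v) _ z := h2
  rw [h3.fderiv]
  fin_cases j <;> simp [A0, multiplier] <;> ring

variable {b : Module.Basis (Fin 2) ℝ Plane}

/-- The covariant derivative `∂_j u - i (A₀ + a)_j u`. -/
def State.cov (s : State b) (j : Fin 2) (z : Plane) : ℂ :=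
  s.du j z - Complex.I * ((A0 z j + s.a j z : ℝ) : ℂ) * s.u z

lemma State.kinetic_eq (s : State b) (z : Plane) :
    s.kinetic z = ‖s.cov 0 z‖ ^ 2 + ‖s.cov 1 z‖ ^ 2 := by
  have : ∀ j, ‖Complex.I * s.du j z + ((A0 z j + s.a j z : ℝ) : ℂ) * s.u z‖ = ‖s.cov j z‖ := by
    intro j
    have e : Complex.I * s.du j z + ((A0 z j + s.a j z : ℝ) : ℂ) * s.u z
        = Complex.I * s.cov j z := by
      rw [State.cov, mul_sub, ← mul_assoc, ← mul_assoc, Complex.I_mul_I]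
      ring
    rw [e, norm_mul, Complex.norm_I, one_mul]
  simp only [State.kinetic, this, Fin.sum_univ_two]

lemma continuous_A0 (j : Fin 2) : Continuous fun z => A0 z j := by
  fin_cases j
  · change Continuous fun z : Plane => -(Real.pi * z 1); fun_prop
  · change Continuous fun z : Plane => Real.pi * z 0; fun_prop

lemma isH1loc_re {f : Plane → ℂ} {df : Fin 2 → Plane → ℂ} (h : IsH1loc f df) :
    IsH1loc (fun z => (f z).re) (fun j z => (df j z).re) where
  locL2 K hK := (h.locL2 K hK).re
  locL2_deriv j K hK := (h.locL2_deriv j K hK).re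
  weak j := (h.weak j).clm_comp Complex.reCLM
    (IsLocLp.mono_exponent (p := 2) h.locL2 one_le_two)
    (IsLocLp.mono_exponent (p := 2) (h.locL2_deriv j) one_le_two)

lemma isH1loc_im {f : Plane → ℂ} {df : Fin 2 → Plane → ℂ} (h : IsH1loc f df) :
    IsH1loc (fun z => (f z).im) (fun j z => (df j z).im) where
  locL2 K hK := (h.locL2 K hK).im
  locL2_deriv j K hK := (h.locL2_deriv j K hK).im
  weak j := (h.weak j).clm_comp Complex.imCLM
    (IsLocLp.mono_exponent (p := 2) h.locL2 one_le_two)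
    (IsLocLp.mono_exponent (p := 2) (h.locL2_deriv j) one_le_two)

namespace State

variable (s : State b)

lemma isLocLp_u : IsLocLp 4 s.u := fun K hK =>
  memLp_re_im_iff.1 ⟨(isH1loc_re s.u_H1).isLocLp_four K hK, (isH1loc_im s.u_H1).isLocLp_four K hK⟩

lemma isLocLp_du (j : Fin 2) : IsLocLp 2 (s.du j) := s.u_H1.locL2_deriv j

lemma isLocLp_a (j : Fin 2) : IsLocLp 4 (s.a j) := (s.a_H1 j).isLocLp_four

lemma isLocLp_da (j i : Fin 2) : IsLocLp 2 (s.da j i) := (s.a_H1 i).locL2_deriv j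

lemma isLocLp_potential (j : Fin 2) : IsLocLp 4 fun z => A0 z j + s.a j z :=
  (continuous_A0 j).isLocLp.add (s.isLocLp_a j)

/-- Rests on the L⁴ embedding: the potential and u are each in L⁴_loc, so their product is in
L²_loc. -/
lemma isLocLp_cov (j : Fin 2) : IsLocLp 2 (s.cov j) := by
  have h1 : IsLocLp 4 fun z => ((A0 z j + s.a j z : ℝ) : ℂ) := fun K hK =>
    (s.isLocLp_potential j K hK).ofReal
  have h2 : IsLocLp 2 fun z => ((A0 z j + s.a j z : ℝ) : ℂ) * s.u z := h1.mulC s.isLocLp_u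
  have h3 := h2.continuous_mulC (φ := fun _ => Complex.I) continuous_const
  refine ((s.isLocLp_du j).sub h3).congr (ae_of_all _ fun z => ?_)
  simp only [State.cov, mul_assoc]

lemma isLocLp_curl : IsLocLp 2 s.curl := (s.isLocLp_da 0 1).sub (s.isLocLp_da 1 0)

/-- Periodicity passes from a to its derivatives by uniqueness of weak derivatives. -/
lemma da_periodic (j i l : Fin 2) : ∀ᵐ z : Plane, s.da j i (z + b l) = s.da j i z :=
  IsWeakPartial.unique (((s.a_H1 i).weak j).comp_add_right (b l)) ((s.a_H1 i).weak j)
    (s.a_periodic l i) (((s.isLocLp_da j i).comp_add_right _).mono_exponent one_le_two)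
    ((s.isLocLp_da j i).mono_exponent one_le_two)

lemma curl_periodic (l : Fin 2) : ∀ᵐ z : Plane, s.curl (z + b l) = s.curl z := by
  filter_upwards [s.da_periodic 0 1 l, s.da_periodic 1 0 l] with z h1 h2
  rw [State.curl, State.curl, h1, h2]

lemma isLocLp_u_one : IsLocLp 1 s.u := s.isLocLp_u.mono_exponent (by norm_num)

/-- The covariant derivatives are sections of the same bundle as `u`. -/
lemma cov_quasiperiodic (j l : Fin 2) :
    ∀ᵐ z : Plane, s.cov j (z + b l) = multiplier (b l) z * s.cov j z := by
  have hm := contDiff_multiplier (b l)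
  have hdu := (s.isLocLp_du j).mono_exponent one_le_two
  have hu := s.isLocLp_u_one
  have hcd : Continuous fun z => fderiv ℝ (multiplier (b l)) z (coordVec j) :=
    (hm.continuous_fderiv (by simp)).clm_apply continuous_const
  have h1 := IsWeakPartial.unique ((s.u_H1.weak j).comp_add_right (b l))
    ((s.u_H1.weak j).smooth_mulC hu hdu hm) (s.u_quasiperiodic l) (hdu.comp_add_right _)
    ((hdu.continuous_mulC hm.continuous).add (hu.continuous_mulC hcd))
  filter_upwards [h1, s.u_quasiperiodic l, s.a_periodic l j] with z e1 e2 e3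
  simp only [State.cov, e1, e2, e3, fderiv_multiplier]
  push_cast
  ring

/-- The components of the supercurrent. -/
def current (j : Fin 2) (z : Plane) : ℝ := (s.u z * (starRingEnd ℂ) (s.cov j z)).im

/-- The curl of the supercurrent. -/
def currentCurl (z : Plane) : ℝ :=
  2 * (s.cov 0 z * (starRingEnd ℂ) (s.cov 1 z)).im + (2 * Real.pi + s.curl z) * ‖s.u z‖ ^ 2

lemma mul_conj_multiplier (v z : Plane) (x y : ℂ) :
    (multiplier v z * x) * (starRingEnd ℂ) (multiplier v z * y) = x * (starRingEnd ℂ) y := by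
  have : multiplier v z * (starRingEnd ℂ) (multiplier v z) = 1 := by
    rw [Complex.mul_conj, Complex.normSq_eq_norm_sq, norm_multiplier]; simp
  rw [map_mul]
  linear_combination (x * (starRingEnd ℂ) y) * this

lemma current_periodic (j l : Fin 2) : ∀ᵐ z : Plane, s.current j (z + b l) = s.current j z := by
  filter_upwards [s.cov_quasiperiodic j l, s.u_quasiperiodic l] with z e1 e2
  rw [current, current, e1, e2, mul_conj_multiplier]

lemma currentCurl_periodic (l : Fin 2) :
    ∀ᵐ z : Plane, s.currentCurl (z + b l) = s.currentCurl z := by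
  filter_upwards [s.cov_quasiperiodic 0 l, s.cov_quasiperiodic 1 l, s.u_quasiperiodic l,
    s.curl_periodic l] with z e1 e2 e3 e4
  rw [currentCurl, currentCurl, e1, e2, e3, e4, mul_conj_multiplier, norm_mul, norm_multiplier,
    one_mul]

lemma isLocLp_conj {p : ℝ≥0∞} {f : Plane → ℂ} (hf : IsLocLp p f) :
    IsLocLp p fun z => (starRingEnd ℂ) (f z) := fun K hK => (hf K hK).star

lemma isLocLp_normSq_u : IsLocLp 2 fun z => ‖s.u z‖ ^ 2 := by
  simp only [sq]
  exact s.isLocLp_u.norm.mul s.isLocLp_u.norm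

lemma isLocLp_current (j : Fin 2) : IsLocLp 1 (s.current j) := fun K hK =>
  (((s.isLocLp_u.mono_exponent (by norm_num : (2 : ℝ≥0∞) ≤ 4)).mulC (r := 1)
    (isLocLp_conj (s.isLocLp_cov j))) K hK).im

lemma isLocLp_currentCurl : IsLocLp 1 s.currentCurl := by
  have h1 : IsLocLp 1 fun z => (s.cov 0 z * (starRingEnd ℂ) (s.cov 1 z)).im := fun K hK =>
    (((s.isLocLp_cov 0).mulC (r := 1) (isLocLp_conj (s.isLocLp_cov 1))) K hK).im
  have h2 : IsLocLp 1 fun z => (2 * Real.pi + s.curl z) * ‖s.u z‖ ^ 2 :=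
    ((continuous_const.isLocLp (p := 2)).add s.isLocLp_curl).mul s.isLocLp_normSq_u
  exact (h1.const_mul 2).add h2

end State

lemma integral_add_add {ν : Measure Plane} {f g h : Plane → ℝ} (hf : Integrable f ν)
    (hg : Integrable g ν) (hh : Integrable h ν) :
    ∫ z, (f z + g z + h z) ∂ν = (∫ z, f z ∂ν) + (∫ z, g z ∂ν) + ∫ z, h z ∂ν := by
  have hfg : Integrable (fun z => f z + g z) ν := hf.add hg
  rw [integral_add hfg hh, integral_add hf hg]

/-! ### The Bogomolny identity -/

namespace State

variable (s : State b)

lemma isWeakPartial_potential_one :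
    IsWeakPartial 0 (fun z => A0 z 1 + s.a 1 z) (fun z => Real.pi + s.da 0 1 z) := by
  have h : IsWeakPartial 0 (fun z : Plane => A0 z 1) _ :=
    isWeakPartial_of_contDiff (f := fun z : Plane => Real.pi * z 0) (by fun_prop) 0
  have hd : ∀ z, fderiv ℝ (fun z : Plane => Real.pi * z 0) z (coordVec 0) = Real.pi := by
    intro z
    have h0 : HasFDerivAt (fun z : Plane => Real.pi * z 0) _ z :=
      ((EuclideanSpace.proj (𝕜 := ℝ) 0 : Plane →L[ℝ] ℝ).hasFDerivAt (x := z)).const_mul Real.pi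
    rw [h0.fderiv]; simp
  simp only [hd] at h
  exact h.add ((s.a_H1 1).weak 0) (continuous_A0 1).isLocLp continuous_const.isLocLp
    ((s.isLocLp_a 1).mono_exponent (by norm_num))
    ((s.isLocLp_da 0 1).mono_exponent one_le_two)

lemma isWeakPartial_potential_zero :
    IsWeakPartial 1 (fun z => A0 z 0 + s.a 0 z) (fun z => -Real.pi + s.da 1 0 z) := by
  have h : IsWeakPartial 1 (fun z : Plane => A0 z 0) _ :=
    isWeakPartial_of_contDiff (f := fun z : Plane => -(Real.pi * z 1)) (by fun_prop) 1
  have hd : ∀ z, fderiv ℝ (fun z : Plane => -(Real.pi * z 1)) z (coordVec 1) = -Real.pi := by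
    intro z
    have h0 : HasFDerivAt (fun z : Plane => -(Real.pi * z 1)) _ z :=
      (((EuclideanSpace.proj (𝕜 := ℝ) 1 : Plane →L[ℝ] ℝ).hasFDerivAt (x := z)).const_mul
        Real.pi).neg
    rw [h0.fderiv]; simp
  simp only [hd] at h
  exact h.add ((s.a_H1 0).weak 1) (continuous_A0 0).isLocLp continuous_const.isLocLp
    ((s.isLocLp_a 0).mono_exponent (by norm_num))
    ((s.isLocLp_da 1 0).mono_exponent one_le_two)

/-- `currentCurl` is the weak curl of `current`. -/
lemma weak_curl_current {χ : Plane → ℝ} (hχ : ContDiff ℝ ∞ χ) (hc : HasCompactSupport χ) :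
    (∫ z, fderiv ℝ χ z (coordVec 0) * s.current 1 z)
      - (∫ z, fderiv ℝ χ z (coordVec 1) * s.current 0 z) = - ∫ z, χ z * s.currentCurl z := by
  set p : Plane → ℝ := fun z => (s.u z).re
  set q : Plane → ℝ := fun z => (s.u z).im
  set dp : Fin 2 → Plane → ℝ := fun j z => (s.du j z).re
  set dq : Fin 2 → Plane → ℝ := fun j z => (s.du j z).im
  set A : Fin 2 → Plane → ℝ := fun j z => A0 z j + s.a j z
  set w : Plane → ℝ := fun z => p z * p z + q z * q z
  set dw : Fin 2 → Plane → ℝ := fun j z =>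
    (p z * dp j z + dp j z * p z) + (q z * dq j z + dq j z * q z)
  have hp : IsH1loc p dp := isH1loc_re s.u_H1
  have hq : IsH1loc q dq := isH1loc_im s.u_H1
  have p4 : IsLocLp 4 p := hp.isLocLp_four
  have q4 : IsLocLp 4 q := hq.isLocLp_four
  have p2 : IsLocLp 2 p := hp.locL2
  have q2 : IsLocLp 2 q := hq.locL2
  have dp2 : ∀ j, IsLocLp 2 (dp j) := hp.locL2_deriv
  have dq2 : ∀ j, IsLocLp 2 (dq j) := hq.locL2_deriv
  have A4 : ∀ j, IsLocLp 4 (A j) := s.isLocLp_potential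
  have A2 : ∀ j, IsLocLp 2 (A j) := fun j => (A4 j).mono_exponent (by norm_num)
  have w2 : IsLocLp 2 w := (p4.mul p4).add (q4.mul q4)
  have dw43 : ∀ j, IsLocLp (4 / 3) (dw j) := fun j =>
    ((p4.mul (dp2 j)).add ((dp2 j).mul p4)).add ((q4.mul (dq2 j)).add ((dq2 j).mul q4))
  have hw : ∀ j, IsWeakPartial j w (dw j) := fun j =>
    ((hp.weak j).mul (p := 2) (q := 2) (by simp) (hp.weak j) p2 p2 (dp2 j) p2 (dp2 j)).add
      ((hq.weak j).mul (p := 2) (q := 2) (by simp) (hq.weak j) q2 q2 (dq2 j) q2 (dq2 j))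
      (p2.mul p2) ((p2.mul (dp2 j)).add ((dp2 j).mul p2))
      (q2.mul q2) ((q2.mul (dq2 j)).add ((dq2 j).mul q2))
  have dA1 : IsLocLp 2 (fun z => Real.pi + s.da 0 1 z) :=
    continuous_const.isLocLp.add (s.isLocLp_da 0 1)
  have dA0 : IsLocLp 2 (fun z => -Real.pi + s.da 1 0 z) :=
    continuous_const.isLocLp.add (s.isLocLp_da 1 0)
  -- With u = p + iq the current is q∇p - p∇q + A w. The product rule with exponents 4 and 4/3
  -- handles A w; the Jacobian identity handles the other two terms.
  have r1 := s.isWeakPartial_potential_one.mul (p := 4) (q := 4 / 3) (by simp) (hw 0)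
    (A2 1) (A4 1) dA1 w2 (dw43 0) χ hχ hc
  have r0 := s.isWeakPartial_potential_zero.mul (p := 4) (q := 4 / 3) (by simp) (hw 1)
    (A2 0) (A4 0) dA0 w2 (dw43 1) χ hχ hc
  have cqp := integral_curl_mul_grad hq hp hχ hc
  have cpq := integral_curl_mul_grad hp hq hχ hc
  simp only [smul_eq_mul] at r1 r0
  have hJ : ∀ j z, s.current j z = q z * dp j z - p z * dq j z + A j z * w z := by
    intro j z
    simp [current, cov, p, q, dp, dq, A, w]
    ring
  have hG : ∀ z, s.currentCurl z = (dq 0 z * dp 1 z - dq 1 z * dp 0 z)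
      - (dp 0 z * dq 1 z - dp 1 z * dq 0 z) + (A 1 z * dw 0 z + (Real.pi + s.da 0 1 z) * w z)
      - (A 0 z * dw 1 z + (-Real.pi + s.da 1 0 z) * w z) := by
    intro z
    have : ‖s.u z‖ ^ 2 = w z := by
      rw [← Complex.normSq_eq_norm_sq, Complex.normSq_apply]
    rw [currentCurl, this]
    simp [curl, cov, p, q, dp, dq, A, w, dw]
    ring
  have iP : ∀ i j, Integrable (fun z => fderiv ℝ χ z (coordVec i) * (q z * dp j z)) volume :=
    fun i j => integrable_partial_smul (f := fun z => q z * dp j z) (q2.mul (dp2 j)) hχ hc _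
  have iQ : ∀ i j, Integrable (fun z => fderiv ℝ χ z (coordVec i) * (p z * dq j z)) volume :=
    fun i j => integrable_partial_smul (f := fun z => p z * dq j z) (p2.mul (dq2 j)) hχ hc _
  have iA : ∀ i j, Integrable (fun z => fderiv ℝ χ z (coordVec i) * (A j z * w z)) volume :=
    fun i j => integrable_partial_smul (f := fun z => A j z * w z) ((A2 j).mul w2) hχ hc _
  have jQ : Integrable (fun z => χ z * (dq 0 z * dp 1 z - dq 1 z * dp 0 z)) volume :=
    integrable_test_smul (f := fun z => dq 0 z * dp 1 z - dq 1 z * dp 0 z)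
      (((dq2 0).mul (dp2 1)).sub ((dq2 1).mul (dp2 0))) hχ hc
  have jP : Integrable (fun z => χ z * (dp 0 z * dq 1 z - dp 1 z * dq 0 z)) volume :=
    integrable_test_smul (f := fun z => dp 0 z * dq 1 z - dp 1 z * dq 0 z)
      (((dp2 0).mul (dq2 1)).sub ((dp2 1).mul (dq2 0))) hχ hc
  have j1 : Integrable (fun z => χ z * (A 1 z * dw 0 z + (Real.pi + s.da 0 1 z) * w z)) volume :=
    integrable_test_smul (f := fun z => A 1 z * dw 0 z + (Real.pi + s.da 0 1 z) * w z)
      (((A4 1).mul (dw43 0)).add (dA1.mul w2)) hχ hc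
  have j0 : Integrable (fun z => χ z * (A 0 z * dw 1 z + (-Real.pi + s.da 1 0 z) * w z)) volume :=
    integrable_test_smul (f := fun z => A 0 z * dw 1 z + (-Real.pi + s.da 1 0 z) * w z)
      (((A4 0).mul (dw43 1)).add (dA0.mul w2)) hχ hc
  have eJ : ∀ i j, ∫ z, fderiv ℝ χ z (coordVec i) * s.current j z
      = (∫ z, fderiv ℝ χ z (coordVec i) * (q z * dp j z))
        - (∫ z, fderiv ℝ χ z (coordVec i) * (p z * dq j z))
        + ∫ z, fderiv ℝ χ z (coordVec i) * (A j z * w z) := by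
    intro i j
    have := integral_add_add (iP i j) (iQ i j).neg (iA i j)
    simp only [Pi.neg_apply, integral_neg] at this
    rw [sub_eq_add_neg, ← this]
    exact integral_congr_ae (ae_of_all _ fun z => by simp only [hJ]; ring)
  have eG : ∫ z, χ z * s.currentCurl z
      = (∫ z, χ z * (dq 0 z * dp 1 z - dq 1 z * dp 0 z))
        - (∫ z, χ z * (dp 0 z * dq 1 z - dp 1 z * dq 0 z))
        + (∫ z, χ z * (A 1 z * dw 0 z + (Real.pi + s.da 0 1 z) * w z))
        - ∫ z, χ z * (A 0 z * dw 1 z + (-Real.pi + s.da 1 0 z) * w z) := by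
    have := integral_add_add (jQ.sub jP) j1 j0.neg
    simp only [Pi.neg_apply, Pi.sub_apply, integral_neg] at this
    rw [← integral_sub jQ jP, sub_eq_add_neg, ← this]
    exact integral_congr_ae (ae_of_all _ fun z => by simp only [hG]; ring)
  rw [integral_sub (iP 0 1) (iP 1 0)] at cqp
  rw [integral_sub (iQ 0 1) (iQ 1 0)] at cpq
  rw [eJ, eJ, eG]
  linear_combination cqp - cpq + r1 - r0

lemma setIntegral_currentCurl :
    ∫ z in ZSpan.fundamentalDomain b, s.currentCurl z = 0 :=
  setIntegral_weak_curl_eq_zero s.isLocLp_current s.isLocLp_currentCurl s.current_periodic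
    s.currentCurl_periodic fun _ hχ hc => s.weak_curl_current hχ hc

/-- The flux is thus carried by A₀ alone, and any constant multiple of curl a may be added to an
energy density for free. -/
lemma setIntegral_curl : ∫ z in ZSpan.fundamentalDomain b, s.curl z = 0 := by
  have one2 : ∀ {h : Plane → ℝ}, IsLocLp 2 h → IsLocLp 1 h := fun h => h.mono_exponent one_le_two
  refine setIntegral_weak_curl_eq_zero (J := s.a)
    (fun j => (s.isLocLp_a j).mono_exponent (by norm_num)) (one2 s.isLocLp_curl)
    (fun j i => s.a_periodic i j) s.curl_periodic fun χ hχ hc => ?_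
  have h1 := (s.a_H1 1).weak 0 χ hχ hc
  have h0 := (s.a_H1 0).weak 1 χ hχ hc
  simp only [smul_eq_mul] at h0 h1
  have i1 : Integrable (fun z => χ z * s.da 0 1 z) volume :=
    integrable_test_smul (one2 (s.isLocLp_da 0 1)) hχ hc
  have i0 : Integrable (fun z => χ z * s.da 1 0 z) volume :=
    integrable_test_smul (one2 (s.isLocLp_da 1 0)) hχ hc
  simp only [curl, mul_sub]
  rw [integral_sub i1 i0, h1, h0]
  ring

lemma isBounded_domain : Bornology.IsBounded (ZSpan.fundamentalDomain b) :=
  ZSpan.fundamentalDomain_isBounded b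

lemma isLocLp_normSq_cov (j : Fin 2) : IsLocLp 1 fun z => ‖s.cov j z‖ ^ 2 := by
  simp only [sq]
  exact (s.isLocLp_cov j).norm.mul (s.isLocLp_cov j).norm

lemma isLocLp_kinetic : IsLocLp 1 s.kinetic :=
  ((s.isLocLp_normSq_cov 0).add (s.isLocLp_normSq_cov 1)).congr
    (ae_of_all _ fun z => (s.kinetic_eq z).symm)

lemma isLocLp_field_mul : IsLocLp 1 fun z => (2 * Real.pi + s.curl z) * ‖s.u z‖ ^ 2 :=
  ((continuous_const.isLocLp (p := 2)).add s.isLocLp_curl).mul s.isLocLp_normSq_u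

/-- The pointwise form of the Bogomolny identity. -/
lemma kinetic_add_currentCurl (z : Plane) :
    s.kinetic z + s.currentCurl z = ‖s.cov 0 z + Complex.I * s.cov 1 z‖ ^ 2
      + (2 * Real.pi + s.curl z) * ‖s.u z‖ ^ 2 := by
  rw [s.kinetic_eq, currentCurl]
  simp only [← Complex.normSq_eq_norm_sq, Complex.normSq_apply]
  simp
  ring

/-- The Bogomolny identity. -/
theorem setIntegral_kinetic :
    ∫ z in ZSpan.fundamentalDomain b, s.kinetic z
      = (∫ z in ZSpan.fundamentalDomain b, ‖s.cov 0 z + Complex.I * s.cov 1 z‖ ^ 2)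
        + ∫ z in ZSpan.fundamentalDomain b, (2 * Real.pi + s.curl z) * ‖s.u z‖ ^ 2 := by
  have hK := s.isLocLp_kinetic.integrableOn le_rfl (isBounded_domain (b := b))
  have hC := s.isLocLp_currentCurl.integrableOn le_rfl (isBounded_domain (b := b))
  have hF := s.isLocLp_field_mul.integrableOn le_rfl (isBounded_domain (b := b))
  have h1 := integral_add hK hC
  rw [s.setIntegral_currentCurl, add_zero] at h1
  have h2 : IntegrableOn (fun z => ‖s.cov 0 z + Complex.I * s.cov 1 z‖ ^ 2)
      (ZSpan.fundamentalDomain b) volume := by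
    refine ((hK.add hC).sub hF).congr (ae_of_all _ fun z => ?_)
    simp only [Pi.add_apply, Pi.sub_apply, s.kinetic_add_currentCurl]
    ring
  rw [← h1, ← integral_add h2 hF]
  exact integral_congr_ae (ae_of_all _ fun z => s.kinetic_add_currentCurl z)

/-! ### The energy -/

lemma isLocLp_condensation : IsLocLp 1 fun z => (1 - ‖s.u z‖ ^ 2) ^ 2 := by
  have h : IsLocLp 2 fun z => 1 - ‖s.u z‖ ^ 2 :=
    (continuous_const.isLocLp (p := 2)).sub s.isLocLp_normSq_u
  simp only [sq (1 - ‖s.u _‖ ^ 2)]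
  exact h.mul h

lemma isLocLp_curl_sq : IsLocLp 1 fun z => s.curl z ^ 2 := by
  simp only [sq]
  exact s.isLocLp_curl.mul s.isLocLp_curl

lemma kinetic_nonneg (z : Plane) : 0 ≤ s.kinetic z := by
  rw [s.kinetic_eq]; positivity

lemma density_nonneg {k Hint : ℝ} (hk : 0 < k) (hH : 0 < Hint) (z : Plane) :
    0 ≤ s.density k Hint z := by
  have := s.kinetic_nonneg z
  simp only [density]
  positivity

lemma integrableOn_density (k Hint : ℝ) :
    IntegrableOn (s.density k Hint) (ZSpan.fundamentalDomain b) volume :=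
  IsLocLp.integrableOn (((s.isLocLp_kinetic.const_mul _).add
    (s.isLocLp_condensation.const_mul _)).add (s.isLocLp_curl_sq.const_mul _)) le_rfl
    isBounded_domain

/-- The energy is finite, and is given by a Bochner integral. -/
lemma energy_eq {k Hext Hint : ℝ} (hk : 0 < k) (hH : 0 < Hint) :
    s.energy k Hext Hint = ENNReal.ofReal
      ((∫ z in ZSpan.fundamentalDomain b, s.density k Hint z) + 1 / 2 * (Hint - Hext) ^ 2) := by
  rw [energy, internalEnergy, ← ofReal_integral_eq_lintegral_ofReal (s.integrableOn_density k Hint)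
    (ae_of_all _ (s.density_nonneg hk hH)), ENNReal.ofReal_add
    (integral_nonneg (s.density_nonneg hk hH)) (by positivity)]

/-- The integral of the energy density, after the Bogomolny identity. -/
lemma setIntegral_density (k Hint : ℝ) :
    ∫ z in ZSpan.fundamentalDomain b, s.density k Hint z
      = Hint / (2 * Real.pi * k) / 2
          * (∫ z in ZSpan.fundamentalDomain b, ‖s.cov 0 z + Complex.I * s.cov 1 z‖ ^ 2)
        + ∫ z in ZSpan.fundamentalDomain b,
            (Hint / (2 * Real.pi * k) / 2 * ((2 * Real.pi + s.curl z) * ‖s.u z‖ ^ 2)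
              + 1 / 4 * (1 - ‖s.u z‖ ^ 2) ^ 2
              + (Hint / (2 * Real.pi * k)) ^ 2 * k ^ 2 / 2 * s.curl z ^ 2) := by
  have hB := isBounded_domain (b := b)
  set μ := Hint / (2 * Real.pi * k)
  have hK := (s.isLocLp_kinetic.const_mul (μ / 2)).integrableOn le_rfl hB
  have hC := (s.isLocLp_condensation.const_mul (1 / 4)).integrableOn le_rfl hB
  have hF := (s.isLocLp_field_mul.const_mul (μ / 2)).integrableOn le_rfl hB
  have hS := (s.isLocLp_curl_sq.const_mul (μ ^ 2 * k ^ 2 / 2)).integrableOn le_rfl hB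
  have e1 : ∫ z in ZSpan.fundamentalDomain b, s.density k Hint z
      = (∫ z in ZSpan.fundamentalDomain b, μ / 2 * s.kinetic z)
        + (∫ z in ZSpan.fundamentalDomain b, 1 / 4 * (1 - ‖s.u z‖ ^ 2) ^ 2)
        + ∫ z in ZSpan.fundamentalDomain b, μ ^ 2 * k ^ 2 / 2 * s.curl z ^ 2 := by
    rw [← integral_add_add hK hC hS]
    rfl
  have e2 : ∫ z in ZSpan.fundamentalDomain b, (μ / 2 * ((2 * Real.pi + s.curl z) * ‖s.u z‖ ^ 2)
              + 1 / 4 * (1 - ‖s.u z‖ ^ 2) ^ 2 + μ ^ 2 * k ^ 2 / 2 * s.curl z ^ 2)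
      = (∫ z in ZSpan.fundamentalDomain b, μ / 2 * ((2 * Real.pi + s.curl z) * ‖s.u z‖ ^ 2))
        + (∫ z in ZSpan.fundamentalDomain b, 1 / 4 * (1 - ‖s.u z‖ ^ 2) ^ 2)
        + ∫ z in ZSpan.fundamentalDomain b, μ ^ 2 * k ^ 2 / 2 * s.curl z ^ 2 := by
    rw [← integral_add_add hF hC hS]
  rw [e1, e2, integral_const_mul (μ / 2) s.kinetic, s.setIntegral_kinetic,
    integral_const_mul (μ / 2) fun z => (2 * Real.pi + s.curl z) * ‖s.u z‖ ^ 2]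
  ring

end State

/-- With x = w/(2k), the right side minus 1/4 is (H - k) x + (t + x)²/2 + (k² - 1/2) x². Each term
is nonnegative; the last is where the type II condition enters. -/
lemma quarter_le_energy_density {k H w t : ℝ} (hk : 1 / Real.sqrt 2 ≤ k) (hH : k ≤ H)
    (hw : 0 ≤ w) :
    1 / 4 ≤ (H + t) * w / (2 * k) + 1 / 4 * (1 - w) ^ 2 + t ^ 2 / 2 := by
  have hk0 : 0 < k := lt_of_lt_of_le (by positivity) hk
  have hk2 : 1 / 2 ≤ k ^ 2 := by
    have h := pow_le_pow_left₀ (by positivity) hk 2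
    rwa [div_pow, Real.sq_sqrt (by norm_num), one_pow] at h
  set x := w / (2 * k)
  have hw' : w = 2 * k * x := by simp only [x]; field_simp
  have hx : 0 ≤ x := by positivity
  have e : (H + t) * w / (2 * k) = (H + t) * x := by simp only [x]; ring
  rw [e, hw']
  nlinarith [mul_nonneg (sub_nonneg.2 hH) hx, sq_nonneg (t + x),
    mul_nonneg (sub_nonneg.2 hk2) (sq_nonneg x)]

/-- The lower bound for the energy in a strong external field. -/
theorem State.quarter_le (s : State b) (hb : volume (ZSpan.fundamentalDomain b) = 1)
    {k Hext Hint : ℝ} (hk : 1 / Real.sqrt 2 ≤ k) (hH : k ≤ Hext) (hHint : 0 < Hint) :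
    1 / 4 ≤ (∫ z in ZSpan.fundamentalDomain b, s.density k Hint z)
      + 1 / 2 * (Hint - Hext) ^ 2 := by
  have hk0 : 0 < k := lt_of_lt_of_le (by positivity) hk
  have hB := State.isBounded_domain (b := b)
  have hbr : volume.real (ZSpan.fundamentalDomain b) = 1 := by simp [Measure.real, hb]
  set D := ZSpan.fundamentalDomain b
  set μ := Hint / (2 * Real.pi * k) with hμ
  have hμ0 : 0 < μ := by positivity
  have hC := (s.isLocLp_condensation.const_mul (1 / 4)).integrableOn le_rfl hB
  have hF := (s.isLocLp_field_mul.const_mul (μ / 2)).integrableOn le_rfl hB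
  have hS := (s.isLocLp_curl_sq.const_mul (μ ^ 2 * k ^ 2 / 2)).integrableOn le_rfl hB
  have hL := (s.isLocLp_curl.const_mul (μ * k * (Hint - Hext))).integrableOn one_le_two hB
  have hconst : ∀ c : ℝ, IntegrableOn (fun _ : Plane => c) D volume := fun c =>
    integrableOn_const (by rw [hb]; simp)
  have hdef : 0 ≤ μ / 2 * ∫ z in D, ‖s.cov 0 z + Complex.I * s.cov 1 z‖ ^ 2 :=
    mul_nonneg (by positivity) (integral_nonneg fun z => by positivity)
  rw [s.setIntegral_density]
  -- The added term linear in curl a integrates to zero. It is the cross term completing the square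
  -- t²/2 for t = H_int - H_ext + μ k curl a, and H_ext + t = μ k (2π + curl a) because H_int =
  -- 2πkμ.
  have hlow : ∫ _ in D, (1 / 4 : ℝ) ≤ ∫ z in D, ((μ / 2 * ((2 * Real.pi + s.curl z) * ‖s.u z‖ ^ 2)
      + 1 / 4 * (1 - ‖s.u z‖ ^ 2) ^ 2 + μ ^ 2 * k ^ 2 / 2 * s.curl z ^ 2)
      + μ * k * (Hint - Hext) * s.curl z + 1 / 2 * (Hint - Hext) ^ 2) := by
    refine integral_mono (hconst _) ((((hF.add hC).add hS).add hL).add (hconst _)) fun z => ?_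
    have h := quarter_le_energy_density (t := Hint - Hext + μ * k * s.curl z) hk hH
      (sq_nonneg ‖s.u z‖)
    have e : Hint = 2 * Real.pi * k * μ := by rw [hμ]; field_simp
    have e2 : (Hext + (Hint - Hext + μ * k * s.curl z)) * ‖s.u z‖ ^ 2 / (2 * k)
        = μ / 2 * ((2 * Real.pi + s.curl z) * ‖s.u z‖ ^ 2) := by
      rw [show Hext + (Hint - Hext + μ * k * s.curl z) = Hint + μ * k * s.curl z by ring, e]
      field_simp
    rw [e2] at h
    refine h.trans_eq ?_
    ring
  have hFCS : IntegrableOn (fun z => μ / 2 * ((2 * Real.pi + s.curl z) * ‖s.u z‖ ^ 2)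
      + 1 / 4 * (1 - ‖s.u z‖ ^ 2) ^ 2 + μ ^ 2 * k ^ 2 / 2 * s.curl z ^ 2) D volume :=
    (hF.add hC).add hS
  rw [integral_add_add hFCS hL (hconst _),
    integral_const_mul _ s.curl, s.setIntegral_curl] at hlow
  simp only [integral_const, measureReal_restrict_apply_univ, hbr, smul_eq_mul] at hlow
  linarith

/-! ### The normal state and attainment of the minimum. -/

lemma isWeakPartial_zero {F : Type} [NormedAddCommGroup F] [NormedSpace ℝ F] (j : Fin 2) :
    IsWeakPartial j (fun _ : Plane => (0 : F)) (fun _ => 0) := fun φ _ _ => by simp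

lemma isH1loc_zero {F : Type} [NormedAddCommGroup F] [NormedSpace ℝ F] :
    IsH1loc (fun _ : Plane => (0 : F)) (fun _ _ => 0) where
  locL2 := IsLocLp.mono_exponent (p := 2) continuous_const.isLocLp le_rfl
  locL2_deriv _ := IsLocLp.mono_exponent (p := 2) continuous_const.isLocLp le_rfl
  weak j := isWeakPartial_zero j

variable (b) in
/-- The normal state. -/
def normalState : State b where
  u _ := 0
  du _ _ := 0
  a _ _ := 0
  da _ _ _ := 0
  u_H1 := isH1loc_zero
  u_quasiperiodic _ := by simp
  a_H1 _ := isH1loc_zero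
  a_periodic _ _ := by simp
  a_div := by simp
  a_mean _ := by simp

lemma normalState_energy (hb : volume (ZSpan.fundamentalDomain b) = 1) (k H : ℝ) :
    (normalState b).energy k H H = normalEnergy := by
  simp [State.energy, State.internalEnergy, State.density, State.kinetic, State.curl, normalState,
    hb, normalEnergy]

theorem isLeast_energyValues (hb : volume (ZSpan.fundamentalDomain b) = 1)
    {k Hext : ℝ} (hk : 1 / Real.sqrt 2 ≤ k) (hH : k ≤ Hext) :
    IsLeast (energyValues b k Hext) normalEnergy := by
  have hk0 : 0 < k := lt_of_lt_of_le (by positivity) hk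
  refine ⟨⟨Hext, hk0.trans_le hH, normalState b, normalState_energy hb k Hext⟩, ?_⟩
  rintro _ ⟨Hint, hHint, s, rfl⟩
  rw [s.energy_eq hk0 hHint, normalEnergy]
  have := ENNReal.ofReal_le_ofReal (s.quarter_le hb hk hH hHint)
  rwa [ENNReal.ofReal_div_of_pos (by norm_num), ENNReal.ofReal_one, ENNReal.ofReal_ofNat] at this

/-! ### Smooth states -/

/-- A smooth section, with vanishing vector potential, is a state. -/
def smoothState (b : Module.Basis (Fin 2) ℝ Plane) (u : Plane → ℂ) (hu : ContDiff ℝ 1 u)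
    (hq : ∀ i z, u (z + b i) = multiplier (b i) z * u z) : State b where
  u := u
  du j z := fderiv ℝ u z (coordVec j)
  a _ _ := 0
  da _ _ _ := 0
  u_H1 :=
    { locL2 := IsLocLp.mono_exponent (p := 2) hu.continuous.isLocLp le_rfl
      locL2_deriv := fun j => IsLocLp.mono_exponent (p := 2) (Continuous.isLocLp
        ((hu.continuous_fderiv one_ne_zero).clm_apply continuous_const)) le_rfl
      weak := isWeakPartial_of_contDiff hu }
  u_quasiperiodic i := ae_of_all _ (hq i)
  a_H1 _ := isH1loc_zero
  a_periodic _ _ := by simp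
  a_div := by simp
  a_mean _ := by simp

lemma smoothState_cov {b : Module.Basis (Fin 2) ℝ Plane} {u : Plane → ℂ} (hu : ContDiff ℝ 1 u)
    (hq : ∀ i z, u (z + b i) = multiplier (b i) z * u z) (j : Fin 2) (z : Plane) :
    (smoothState b u hu hq).cov j z
      = fderiv ℝ u z (coordVec j) - Complex.I * (A0 z j : ℂ) * u z := by
  simp [State.cov, smoothState]

/-! ### The lowest Landau level -/

/-- The complex coordinate on the plane. -/
def toComplex : Plane →L[ℝ] ℂ :=
  Complex.ofRealCLM.comp (EuclideanSpace.proj (𝕜 := ℝ) 0)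
    + Complex.I • Complex.ofRealCLM.comp (EuclideanSpace.proj (𝕜 := ℝ) 1)

lemma toComplex_apply (z : Plane) : toComplex z = z 0 + Complex.I * z 1 := by
  simp [toComplex]

/-- The lowest Landau level function attached to a holomorphic function. -/
def landau (f : ℂ → ℂ) (z : Plane) : ℂ :=
  Complex.exp ((-(Real.pi / 2) * (z 0 ^ 2 + z 1 ^ 2) : ℝ) : ℂ) * f (toComplex z)

lemma contDiff_landau {f : ℂ → ℂ} (hf : Differentiable ℂ f) : ContDiff ℝ 1 (landau f) := by
  have h1 : ContDiff ℝ 1 fun z : Plane => -(Real.pi / 2) * (z 0 ^ 2 + z 1 ^ 2) := by fun_prop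
  have h2 : ContDiff ℝ 1 f := (hf.contDiff (n := 1)).restrict_scalars ℝ
  exact (Complex.ofRealCLM.contDiff.comp h1).cexp.mul (h2.comp toComplex.contDiff)

/-- Lowest Landau level functions solve the first order Bogomolny equation. -/
lemma landau_bogomolny {f : ℂ → ℂ} (hf : Differentiable ℂ f) (z : Plane) :
    (fderiv ℝ (landau f) z (coordVec 0) - Complex.I * (A0 z 0 : ℂ) * landau f z)
      + Complex.I * (fderiv ℝ (landau f) z (coordVec 1) - Complex.I * (A0 z 1 : ℂ) * landau f z)
      = 0 := by
  have h0 : ∀ i : Fin 2, HasFDerivAt (fun z : Plane => z i) (EuclideanSpace.proj (𝕜 := ℝ) i) z :=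
    fun i => (EuclideanSpace.proj (𝕜 := ℝ) i : Plane →L[ℝ] ℝ).hasFDerivAt
  have h1 := (((h0 0).pow 2).add ((h0 1).pow 2)).const_mul (-(Real.pi / 2))
  have h2 := (Complex.ofRealCLM.hasFDerivAt.comp z h1).cexp
  have h3 : HasFDerivAt f ((ContinuousLinearMap.toSpanSingleton ℂ
      (deriv f (toComplex z))).restrictScalars ℝ) (toComplex z) :=
    (hf (toComplex z)).hasDerivAt.hasFDerivAt.restrictScalars ℝ
  have h4 := h3.comp z toComplex.hasFDerivAt
  have h5 : HasFDerivAt (landau f) _ z := h2.mul h4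
  rw [h5.fderiv]
  simp [A0, landau, toComplex_apply]
  ring_nf
  simp only [Complex.I_sq]
  ring

/-- In terms of Z and its conjugate, quasi-periodicity becomes a polynomial identity between
exponents. -/
lemma landau_eq (f : ℂ → ℂ) (z : Plane) : landau f z
    = Complex.exp (-(Real.pi / 2) * (toComplex z * (starRingEnd ℂ) (toComplex z)))
      * f (toComplex z) := by
  rw [landau]
  congr 2
  simp only [toComplex_apply, map_add, map_mul, Complex.conj_ofReal, Complex.conj_I]
  push_cast
  ring_nf
  simp only [Complex.I_sq]
  ring

lemma multiplier_eq (v z : Plane) : multiplier v z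
    = Complex.exp (Real.pi / 2 * (toComplex z * (starRingEnd ℂ) (toComplex v)
        - toComplex v * (starRingEnd ℂ) (toComplex z))) := by
  rw [multiplier]
  congr 1
  simp only [toComplex_apply, map_add, map_mul, Complex.conj_ofReal, Complex.conj_I]
  push_cast
  ring

/-! ### Theta functions -/

/-- The zeroth Fourier coefficient of x ↦ θ(x, τ) is 1: the series may be integrated termwise over
[0, 1], and every term with n ≠ 0 integrates to zero. -/
lemma exists_jacobiTheta₂_ne_zero {τ : ℂ} (hτ : 0 < τ.im) :
    ∃ x : ℂ, jacobiTheta₂ x τ ≠ 0 := by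
  by_contra! h
  have hs : HasSum (fun n : ℤ => ∫ x in (0 : ℝ)..1, jacobiTheta₂_term n x τ)
      (∫ x in (0 : ℝ)..1, jacobiTheta₂ x τ) := by
    refine intervalIntegral.hasSum_integral_of_dominated_convergence
      (fun n _ => ‖jacobiTheta₂_term n 0 τ‖) (fun n => ?_) (fun n => ?_) ?_ ?_ ?_
    · refine Continuous.aestronglyMeasurable ?_
      unfold jacobiTheta₂_term
      fun_prop
    · refine ae_of_all _ fun x _ => ?_
      rw [norm_jacobiTheta₂_term, norm_jacobiTheta₂_term]
      simp
    · exact ae_of_all _ fun _ _ => (hasSum_jacobiTheta₂_term 0 hτ).summable.norm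
    · simp
    · exact ae_of_all _ fun x _ => hasSum_jacobiTheta₂_term _ hτ
  have hn : ∀ n : ℤ, n ≠ 0 → ∫ x in (0 : ℝ)..1, jacobiTheta₂_term n x τ = 0 := by
    intro n hn
    have e : ∀ x : ℝ, jacobiTheta₂_term n x τ
        = Complex.exp ((2 * Real.pi * Complex.I * n) * x)
          * Complex.exp (Real.pi * Complex.I * n ^ 2 * τ) := fun x => by
      rw [jacobiTheta₂_term, ← Complex.exp_add]
    have hc : (2 * Real.pi * Complex.I * n : ℂ) ≠ 0 := by
      simp [Real.pi_ne_zero, hn]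
    simp only [e]
    rw [intervalIntegral.integral_mul_const, integral_exp_mul_complex hc]
    have : Complex.exp (2 * Real.pi * Complex.I * n) = 1 := by
      rw [mul_comm]; exact Complex.exp_int_mul_two_pi_mul_I n
    simp [this]
  have h0 : ∫ x in (0 : ℝ)..1, jacobiTheta₂_term 0 x τ = 1 := by
    simp [jacobiTheta₂_term]
  have h1 := (hasSum_single (0 : ℤ) hn).unique hs
  rw [h0] at h1
  simp [h] at h1

/-- The theta function with the quasi-periods `V` and `W`, in the normalization adapted to the
lowest Landau level. -/
def thetaFn (V W Z : ℂ) : ℂ :=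
  Complex.exp (Real.pi * Z ^ 2 * (starRingEnd ℂ) V / (2 * V)) * jacobiTheta₂ (Z / V) (W / V)

section Theta

variable {v w : Plane}

lemma toComplex_ne_zero (hvw : v 0 * w 1 - v 1 * w 0 = 1) : toComplex v ≠ 0 := by
  intro h
  rw [toComplex_apply] at h
  have h0 : v 0 = 0 := by simpa using congrArg Complex.re h
  have h1 : v 1 = 0 := by simpa using congrArg Complex.im h
  simp [h0, h1] at hvw

/-- The left side is 2i times the signed area of the cell. This fits the area to the quasi-period of
the theta function, as degree one requires. -/
lemma conj_mul_sub (hvw : v 0 * w 1 - v 1 * w 0 = 1) :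
    (starRingEnd ℂ) (toComplex v) * toComplex w
    - toComplex v * (starRingEnd ℂ) (toComplex w) = 2 * Complex.I := by
  have : (v 0 * w 1 - v 1 * w 0 : ℂ) = 1 := by
    rw [← Complex.ofReal_one, ← hvw]; push_cast; rfl
  simp only [toComplex_apply, map_add, map_mul, Complex.conj_ofReal, Complex.conj_I]
  linear_combination (2 * Complex.I) * this

lemma im_period_ratio_pos (hvw : v 0 * w 1 - v 1 * w 0 = 1) : 0 < (toComplex w / toComplex v).im := by
  have h0 := Complex.normSq_pos.2 (toComplex_ne_zero hvw)
  rw [Complex.div_im]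
  have : (toComplex w).im * (toComplex v).re / Complex.normSq (toComplex v)
      - (toComplex w).re * (toComplex v).im / Complex.normSq (toComplex v)
      = 1 / Complex.normSq (toComplex v) := by
    rw [← sub_div]
    congr 1
    simp only [toComplex_apply]
    simp
    linarith
  rw [this]
  positivity

lemma differentiable_thetaFn (hvw : v 0 * w 1 - v 1 * w 0 = 1) : Differentiable ℂ (thetaFn (toComplex v) (toComplex w)) := by
  have h1 : Differentiable ℂ fun Z : ℂ => jacobiTheta₂ (Z / toComplex v)
      (toComplex w / toComplex v) := fun Z =>
    DifferentiableAt.comp (g := fun x => jacobiTheta₂ x (toComplex w / toComplex v)) Z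
      (differentiableAt_jacobiTheta₂_fst (Z / toComplex v) (im_period_ratio_pos hvw))
      (differentiableAt_id.div_const _)
  unfold thetaFn
  exact Differentiable.mul (by fun_prop) h1

lemma exists_landau_thetaFn_ne_zero (hvw : v 0 * w 1 - v 1 * w 0 = 1) :
    ∃ z, landau (thetaFn (toComplex v) (toComplex w)) z ≠ 0 := by
  obtain ⟨x, hx⟩ := exists_jacobiTheta₂_ne_zero (im_period_ratio_pos hvw)
  have hV := toComplex_ne_zero hvw
  set Z := x * toComplex v
  refine ⟨!₂[Z.re, Z.im], ?_⟩
  have hZ : toComplex !₂[Z.re, Z.im] = Z := by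
    rw [toComplex_apply]
    simp [mul_comm Complex.I, Complex.re_add_im]
  rw [landau, hZ, thetaFn, show Z / toComplex v = x by simp only [Z]; field_simp]
  simp [Complex.exp_ne_zero, hx]

/-- Theta has period 1, so the whole multiplier comes from the two Gaussian factors. -/
lemma landau_thetaFn_add_first (hvw : v 0 * w 1 - v 1 * w 0 = 1)
    (z : Plane) :
    landau (thetaFn (toComplex v) (toComplex w)) (z + v)
      = multiplier v z * landau (thetaFn (toComplex v) (toComplex w)) z := by
  have hV := toComplex_ne_zero hvw
  simp only [landau_eq, multiplier_eq, thetaFn, map_add]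
  set V := toComplex v
  set W := toComplex w
  set Z := toComplex z
  rw [show (Z + V) / V = Z / V + 1 by field_simp, jacobiTheta₂_add_left]
  simp only [← mul_assoc, ← Complex.exp_add]
  congr 2
  field_simp
  ring

/-- Theta contributes exp(-πi(W + 2Z)/V). The exponents then differ from that of the multiplier by a
multiple of (W + 2Z)(V̄W - VW̄ - 2i), which vanishes for unit area. -/
lemma landau_thetaFn_add_second (hvw : v 0 * w 1 - v 1 * w 0 = 1)
    (z : Plane) :
    landau (thetaFn (toComplex v) (toComplex w)) (z + w)
      = multiplier w z * landau (thetaFn (toComplex v) (toComplex w)) z := by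
  have hV := toComplex_ne_zero hvw
  have hc := conj_mul_sub hvw
  simp only [landau_eq, multiplier_eq, thetaFn, map_add]
  set V := toComplex v
  set W := toComplex w
  set Z := toComplex z
  rw [show (Z + W) / V = Z / V + W / V by field_simp, jacobiTheta₂_add_left']
  simp only [← mul_assoc, ← Complex.exp_add]
  congr 2
  field_simp
  linear_combination (W + 2 * Z) * hc

end Theta

/-! ### The upper bound for the energy in a weak external field -/

/-- The area fixes the determinant only up to sign, as the basis may have either orientation. -/
lemma abs_det_eq_one {b : Module.Basis (Fin 2) ℝ Plane}
    (hb : volume (ZSpan.fundamentalDomain b) = 1) :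
    |b 0 0 * b 1 1 - b 0 1 * b 1 0| = 1 := by
  set e := EuclideanSpace.basisFun (Fin 2) ℝ
  have h1 : volume (ZSpan.fundamentalDomain e.toBasis) = 1 := by
    rw [measure_congr (ZSpan.fundamentalDomain_ae_parallelepiped e.toBasis volume)]
    simpa using e.volume_parallelepiped
  have h := ZSpan.measure_fundamentalDomain b volume e.toBasis
  rw [hb, h1, mul_one, Module.Basis.det_apply, Matrix.det_fin_two] at h
  have h2 := ENNReal.ofReal_eq_one.1 h.symm
  rw [← h2]
  simp [Module.Basis.toMatrix_apply, e]
  congr 1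
  ring

/-- A nonzero solution of the first order Bogomolny equation. -/
lemma exists_bogomolny_section {b : Module.Basis (Fin 2) ℝ Plane}
    (hb : volume (ZSpan.fundamentalDomain b) = 1) :
    ∃ f : ℂ → ℂ, Differentiable ℂ f ∧
      (∀ i z, landau f (z + b i) = multiplier (b i) z * landau f z) ∧ ∃ z, landau f z ≠ 0 := by
  rcases (abs_eq zero_le_one).1 (abs_det_eq_one hb) with h | h
  · refine ⟨_, differentiable_thetaFn h, fun i => ?_, exists_landau_thetaFn_ne_zero h⟩
    fin_cases i
    · exact landau_thetaFn_add_first h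
    · exact landau_thetaFn_add_second h
  -- For a negatively oriented basis, exchange the generators; the quasi-periodicity conditions are
  -- symmetric in them.
  · have h' : b 1 0 * b 0 1 - b 1 1 * b 0 0 = 1 := by linarith
    refine ⟨_, differentiable_thetaFn h', fun i => ?_, exists_landau_thetaFn_ne_zero h'⟩
    fin_cases i
    · exact landau_thetaFn_add_second h'
    · exact landau_thetaFn_add_first h'

/-- A nonnegative nonzero continuous periodic function has positive integral over a period. -/
lemma setIntegral_pos_of_periodic {b : Module.Basis (Fin 2) ℝ Plane} {g : Plane → ℝ}
    (hg : Continuous g) (h0 : ∀ z, 0 ≤ g z) (hp : ∀ i z, g (z + b i) = g z)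
    (hne : ∃ z, g z ≠ 0) : 0 < ∫ z in ZSpan.fundamentalDomain b, g z := by
  refine lt_of_le_of_ne (integral_nonneg h0) fun hz => ?_
  have hD : MeasurableSet (ZSpan.fundamentalDomain b) := ZSpan.fundamentalDomain_measurableSet b
  have h1 : ∀ v : Plane, ∀ᵐ z, z - v ∈ ZSpan.fundamentalDomain b → g z = 0 := by
    intro v
    have h2 := setIntegral_comp_add_right (fun i => ae_of_all _ (hp i)) v
    have hgv : Continuous fun z => g (v + z) := by fun_prop
    rw [← hz, integral_eq_zero_iff_of_nonneg (fun z => h0 _)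
      (hgv.isLocLp.integrableOn (p := 1) le_rfl State.isBounded_domain)] at h2
    have h3 := (ae_restrict_iff' hD).1 h2
    have h4 := (measurePreserving_sub_right volume v).quasiMeasurePreserving.ae h3
    filter_upwards [h4] with z hz hzD
    simpa using hz hzD
  -- The lattice is countable, so vanishing almost everywhere on each translated cell gives
  -- vanishing almost everywhere on the plane, and by continuity everywhere.
  have h2 : ∀ᵐ z : Plane, ∀ l : Submodule.span ℤ (range b),
      z - (l : Plane) ∈ ZSpan.fundamentalDomain b → g z = 0 := ae_all_iff.2 fun l => h1 l
  have h3 : g =ᵐ[volume] fun _ => 0 := by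
    filter_upwards [h2] with z hz
    exact hz (ZSpan.floor b z) (ZSpan.fract_mem_fundamentalDomain b z)
  obtain ⟨z, hz⟩ := hne
  exact hz (congrFun ((hg.ae_eq_iff_eq volume continuous_const).1 h3) z)

/-- In a weak external field some mixed state has less energy than the normal state. -/
theorem exists_energy_lt {b : Module.Basis (Fin 2) ℝ Plane}
    (hb : volume (ZSpan.fundamentalDomain b) = 1) {k H : ℝ} (hH : 0 < H) (hk : H < k) :
    ∃ s : State b, s.energy k H H < normalEnergy := by
  obtain ⟨f, hf, hq, hne⟩ := exists_bogomolny_section hb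
  have hk0 : 0 < k := hH.trans hk
  have hbr : volume.real (ZSpan.fundamentalDomain b) = 1 := by simp [Measure.real, hb]
  have hB := State.isBounded_domain (b := b)
  have hc := (contDiff_landau hf).continuous
  set D := ZSpan.fundamentalDomain b
  set M := ∫ z in D, ‖landau f z‖ ^ 2
  set Q := ∫ z in D, ‖landau f z‖ ^ 4
  have hM : 0 < M := by
    refine setIntegral_pos_of_periodic (hc.norm.pow 2) (fun z => by positivity) (fun i z => ?_)
      (hne.imp fun z hz => by simpa using hz)
    rw [hq, norm_mul, norm_multiplier, one_mul]
  have hQ : 0 ≤ Q := integral_nonneg fun z => by positivity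
  set c := 1 - H / k
  have hc0 : 0 < c := sub_pos.2 ((div_lt_one hk0).2 hk)
  -- For the section √t · `landau f` the energy is 1/4 - tcM/2 + t²Q/4. This t gives t²Q ≤ tcM, so
  -- the energy is at most 1/4 - tcM/4; the +1 keeps the denominator positive given only Q ≥ 0.
  set t := c * M / (Q + 1)
  have ht : 0 < t := by positivity
  have htQ : t * (Q + 1) = c * M := by simp only [t]; field_simp
  have hfε : Differentiable ℂ fun Z => (Real.sqrt t : ℂ) * f Z := hf.const_mul _
  have hl : ∀ z, landau (fun Z => (Real.sqrt t : ℂ) * f Z) z = (Real.sqrt t : ℂ) * landau f z :=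
    fun z => by simp only [landau]; ring
  have hqε : ∀ i z, landau (fun Z => (Real.sqrt t : ℂ) * f Z) (z + b i)
      = multiplier (b i) z * landau (fun Z => (Real.sqrt t : ℂ) * f Z) z := fun i z => by
    rw [hl, hl, hq]; ring
  set s := smoothState b _ (contDiff_landau hfε) hqε with hs
  refine ⟨s, ?_⟩
  -- The Bogomolny square vanishes, so the kinetic energy is exactly 2π ∫ |u|².
  have hcov : ∀ z, s.cov 0 z + Complex.I * s.cov 1 z = 0 := fun z => by
    rw [hs, smoothState_cov, smoothState_cov, landau_bogomolny hfε]
  have hcurl : ∀ z, s.curl z = 0 := fun z => by simp [State.curl, hs, smoothState]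
  have hu : ∀ z, ‖s.u z‖ ^ 2 = t * ‖landau f z‖ ^ 2 := fun z => by
    change ‖landau (fun Z => (Real.sqrt t : ℂ) * f Z) z‖ ^ 2 = _
    rw [hl, norm_mul, mul_pow, Complex.norm_real, Real.norm_eq_abs, sq_abs, Real.sq_sqrt ht.le]
  have i0 : IntegrableOn (fun _ : Plane => (1 / 4 : ℝ)) D volume :=
    integrableOn_const (by rw [hb]; simp)
  have i2 : IntegrableOn (fun z => -(t / 2 * c) * ‖landau f z‖ ^ 2) D volume :=
    (continuous_const.mul (hc.norm.pow 2)).isLocLp.integrableOn (p := 1) le_rfl hB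
  have i4 : IntegrableOn (fun z => t ^ 2 / 4 * ‖landau f z‖ ^ 4) D volume :=
    (continuous_const.mul (hc.norm.pow 4)).isLocLp.integrableOn (p := 1) le_rfl hB
  have hE : ∫ z in D, s.density k H z = 1 / 4 - t / 2 * c * M + t ^ 2 / 4 * Q := by
    rw [s.setIntegral_density]
    simp only [hcov, hcurl, hu]
    have e : ∀ z, H / (2 * Real.pi * k) / 2 * ((2 * Real.pi + 0) * (t * ‖landau f z‖ ^ 2))
        + 1 / 4 * (1 - t * ‖landau f z‖ ^ 2) ^ 2 + (H / (2 * Real.pi * k)) ^ 2 * k ^ 2 / 2 * 0 ^ 2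
        = 1 / 4 + -(t / 2 * c) * ‖landau f z‖ ^ 2 + t ^ 2 / 4 * ‖landau f z‖ ^ 4 := fun z => by
      simp only [c]
      field_simp
      ring
    simp only [e]
    rw [integral_add_add i0 i2 i4, integral_const_mul, integral_const_mul]
    simp [hbr]
    ring
  rw [s.energy_eq hk0 hH, hE, normalEnergy]
  have hlt : 1 / 4 - t / 2 * c * M + t ^ 2 / 4 * Q + 1 / 2 * (H - H) ^ 2 < (1 / 4 : ℝ) := by
    have : t ^ 2 / 4 * Q ≤ t / 4 * (c * M) := by rw [← htQ]; nlinarith [sq_nonneg t]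
    have : 0 < t * (c * M) := by positivity
    nlinarith
  have := (ENNReal.ofReal_lt_ofReal_iff (by norm_num)).2 hlt
  rwa [ENNReal.ofReal_div_of_pos (by norm_num), ENNReal.ofReal_one, ENNReal.ofReal_ofNat] at this

end Abrikosov

end

theorem theorem8
    (b : Module.Basis (Fin 2) ℝ Abrikosov.Plane)
    (hb : volume (ZSpan.fundamentalDomain b) = 1)
    (k Hext : ℝ) (hk : 1 / Real.sqrt 2 ≤ k) (hH : 0 < Hext) :
    (k ≤ Hext →
      Abrikosov.minEnergy b k Hext = Abrikosov.normalEnergy ∧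
      IsLeast (Abrikosov.energyValues b k Hext) Abrikosov.normalEnergy ∧
      (k, Hext) ∈ Abrikosov.normalSet b) ∧
    (Hext < k → (k, Hext) ∉ Abrikosov.normalSet b) := by
  refine ⟨fun h => ?_, fun h hmem => ?_⟩
  · have hl := Abrikosov.isLeast_energyValues hb hk h
    have hm : Abrikosov.minEnergy b k Hext = Abrikosov.normalEnergy := hl.csInf_eq
    exact ⟨hm, hl, lt_of_lt_of_le (by positivity) hk, hH, hm⟩
  · obtain ⟨s, hs⟩ := Abrikosov.exists_energy_lt hb hH h
    have hle : Abrikosov.minEnergy b k Hext ≤ s.energy k Hext Hext :=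
      sInf_le ⟨Hext, hH, s, rfl⟩
    exact (hle.trans_lt hs).ne hmem.2.2
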